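/- **Setting.** Let $\mathcal H$ be a Hilbert space with orthonormal basis $(e_k)_{k\ge 1}$, let $P_n$ be the orthogonal projection onto $\operatorname{span}(e_1,\dots,e_n)$, and let $X$ be a closed densely defined operator in $\mathcal H$ with $e_k\in\operatorname{dom}(X)$ for all $k$. Let $X_n=P_nXP_n$ be its compressions, considered either as operators on $\operatorname{Range}(P_n)$ or as bounded operators on $\mathcal H$. Consider the conditions - (A1) $X$ has compact resolvent (i.e. $\rho(X)\ne\emptyset$ and $(z-X)^{-1}$ is compact for some, equivalently every, $z\in\rho(X)$); - (A2) $\bigcup_n\operatorname{Range}(P_n)$ is a core for $X$; - (A3) there are $C,\alpha>0$ with $|\langle e_j,Xe_k\rangle|\le Ce^{-\alpha|j-k|}$ for all $j\ne k$; - (B1) for some $z_0\in\rho(X)$, $\varepsilon_n:=\|(X_n-X)(z_0-X)^{-1}\|\to0$, with $X_n=P_nXP_n$ acting on $\mathcal H$. *Functional calculus.* Let $f$ be analytic on an open set $U\subseteq\mathbb C$. A contour $\Gamma$ is a finite family of piecewise $C^1$ closed curves. For a closed operator $T$ with $\sigma(T)\subset U$ and $\Gamma\subset U\setminus\sigma(T)$,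 the Dunford–Taylor calculus is $$f(T)=c\,I+\frac1{2\pi i}\int_\Gamma f(z)(z-T)^{-1}\,dz ,$$ where $\Gamma$ is admissible for $T$ in one of two ways: either (a) $T$ is everywhere defined, $\Gamma$ has winding number $1$ around each point of $\sigma(T)$ and $0$ around each point outside $U$, and $c=0$; or (b) $U$ is a neighbourhood of $\infty$, $f(z)\to c=f(\infty)$ as $z\to\infty$, and $\Gamma$ encloses $\sigma(T)\cup\{\infty\}$, i.e. it has winding number $0$ around each point of $\sigma(T)$ and $-1$ around each point outside $U$. **Theorem (Single-operator convergence).** Let $\Gamma$ (with the constant $c$) be admissible for $f$ and $X$ in $U$, and let $f(X)$, $f(X_n)$ be given by the formula above with this $\Gamma$ and $c$. (i) Assume (A1)–(A3). Then $\Gamma$ is admissible for $X_n$, acting on $\operatorname{Range}(P_n)$, for all sufficiently large $n$, and $$\lim_{n\to\infty}\|f(X_n)P_nu-f(X)u\|=0\qquad\text{for all }u\in\mathcal H .$$ If in addition $0$ is enclosed, i.e. $\Gamma$ satisfies the admissibility conditions with $\sigma(X)\cup\{0\}$ in place of $\sigma(X)$, then the same holds for $X_n=P_nXP_n$ acting on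 $\mathcal H$: $\Gamma$ is admissible for $X_n$ for all large $n$, and $f(X_n)u\to f(X)u$ for all $u\in\mathcal H$. (ii) Assume (B1); conditions (A1)–(A3) are not needed. Then, for $X_n=P_nXP_n$ acting on $\mathcal H$, $\Gamma$ is admissible for $X_n$ for all sufficiently large $n$, $$\lim_{n\to\infty}\|f(X_n)-f(X)\|=0,$$ and there is a constant $C_f>0$ such that for all sufficiently large $n$ $$\|f(X_n)-f(X)\|\le C_f\,\|(X_n-X)(z_0-X)^{-1}\| .$$ On a given space $\mathcal H$, the constant $C_f$ depends only on $f$, the set $U$, the contour $\Gamma$ (with the constant $c$), the point $z_0$ and any chosen upper bound $M$ for $\sup_{z\in\Gamma}\|(z-X)^{-1}\|$; in particular it depends neither on $n$ nor otherwise on $X$ or the basis. -/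

import Mathlib

open Filter Topology

noncomputable section

/-! ### Contours -/

/-- A contour: a cycle made of finitely many `C¹` arcs `[0,1] → ℂ`; the arc `i` ends where the arc
`next i` starts.  Since `next` is a permutation, this is the same as a finite family of piecewise
`C¹` closed curves. -/
structure Contour where
  size : ℕ
  arc : Fin size → ℝ → ℂ
  smooth : ∀ i, ContDiffOn ℝ 1 (arc i) (Set.Icc 0 1)
  next : Equiv.Perm (Fin size)
  closed : ∀ i, arc i 1 = arc (next i) 0

namespace Contour

/-- The set of points lying on the contour. -/
def image (Γ : Contour) : Set ℂ := ⋃ i, Γ.arc i '' Set.Icc 0 1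

/-- The contour integral `∫_Γ g(z) dz` of a vector-valued function. -/
def integral {E : Type*} [NormedAddCommGroup E] [NormedSpace ℂ E] (Γ : Contour) (g : ℂ → E) : E :=
  ∑ i, ∫ t in (0 : ℝ)..1, derivWithin (Γ.arc i) (Set.Icc 0 1) t • g (Γ.arc i t)

/-- The index (winding number) `(2πi)⁻¹ ∫_Γ dζ / (ζ - z)`, for `z` off the contour. -/
def index (Γ : Contour) (z : ℂ) : ℂ :=
  (2 * Real.pi * Complex.I)⁻¹ * Γ.integral (fun ζ => (ζ - z)⁻¹)

/-- `Γ` is a positively oriented contour in `U` enclosing the set `S` (which is then bounded). -/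
def Encloses (Γ : Contour) (U S : Set ℂ) : Prop :=
  Γ.image ⊆ U \ S ∧ (∀ z ∈ S, Γ.index z = 1) ∧ (∀ z ∉ U, Γ.index z = 0)

/-- `Γ` is a contour in `U` which, on the Riemann sphere, encloses `S ∪ {∞}`: it runs once in the
negative sense around the points outside `U` and does not wind around the points of `S`.  (The
complement of `U` is then bounded, i.e. `U` is a neighbourhood of `∞`.) -/
def EnclosesWithInfty (Γ : Contour) (U S : Set ℂ) : Prop :=
  Γ.image ⊆ U \ S ∧ (∀ z ∈ S, Γ.index z = 0) ∧ (∀ z ∉ U, Γ.index z = -1)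

/-- `Γ` is an admissible contour in `U` for the Dunford–Taylor integral of `f` at an operator with
spectrum `S`, with additive constant `c`.  For an everywhere defined operator one may use a contour
around the spectrum (and `c = 0`); in general one uses a contour around the extended spectrum
`S ∪ {∞}`, and `c = f(∞)`. -/
def Admissible (Γ : Contour) (f : ℂ → ℂ) (c : ℂ) (U S : Set ℂ) (everywhereDefined : Prop) : Prop :=
  (everywhereDefined ∧ Γ.Encloses U S ∧ c = 0) ∨
    (Γ.EnclosesWithInfty U S ∧ Tendsto f (Bornology.cobounded ℂ) (𝓝 c))

end Contour

/-- The Dunford–Taylor integral `c + (2πi)⁻¹ ∫_Γ f(z) R(z) dz`, where `R` is the resolvent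
`z ↦ (z - T)⁻¹` of the operator `T` in question. -/
def dunfordTaylor {E : Type*} [NormedAddCommGroup E] [NormedSpace ℂ E]
    (f : ℂ → ℂ) (c : ℂ) (Γ : Contour) (R : ℂ → E →L[ℂ] E) : E →L[ℂ] E :=
  c • ContinuousLinearMap.id ℂ E +
    (2 * Real.pi * Complex.I : ℂ)⁻¹ • Γ.integral (fun z => f z • R z)

/-! ### Resolvent and spectrum of an unbounded operator -/

section Unbounded

variable {H : Type*} [NormedAddCommGroup H] [InnerProductSpace ℂ H]

/-- The bounded operator `R` is a two-sided inverse `H → dom X` of `z - X`. -/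
def IsResolventAt (X : H →ₗ.[ℂ] H) (z : ℂ) (R : H →L[ℂ] H) : Prop :=
  (∀ y, ∃ h : R y ∈ X.domain, z • R y - X ⟨R y, h⟩ = y) ∧
    ∀ x : X.domain, R (z • (x : H) - X x) = x

/-- The resolvent set `ρ(X)`. -/
def unboundedResolventSet (X : H →ₗ.[ℂ] H) : Set ℂ := {z | ∃ R, IsResolventAt X z R}

/-- The spectrum `σ(X) = ℂ \ ρ(X)`. -/
def unboundedSpectrum (X : H →ₗ.[ℂ] H) : Set ℂ := (unboundedResolventSet X)ᶜ

open Classical in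
/-- The resolvent `(z - X)⁻¹`, for `z ∈ ρ(X)` (and `0` otherwise). -/
def unboundedResolvent (X : H →ₗ.[ℂ] H) (z : ℂ) : H →L[ℂ] H :=
  if h : z ∈ unboundedResolventSet X then h.choose else 0

theorem unboundedResolvent_spec {X : H →ₗ.[ℂ] H} {z : ℂ} (hz : z ∈ unboundedResolventSet X) :
    IsResolventAt X z (unboundedResolvent X z) := by
  unfold unboundedResolvent
  rw [dif_pos hz]
  exact hz.choose_spec

/-- `X` has compact resolvent. -/
def HasCompactResolvent (X : H →ₗ.[ℂ] H) : Prop :=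
  ∃ z ∈ unboundedResolventSet X, IsCompactOperator (unboundedResolvent X z)

/-- The operator `X (z - X)⁻¹`, which is everywhere defined and bounded for `z ∈ ρ(X)`. -/
def mulResolvent (X : H →ₗ.[ℂ] H) (z : ℂ) (hz : z ∈ unboundedResolventSet X) : H →L[ℂ] H where
  toLinearMap := X.toFun ∘ₗ
    (unboundedResolvent X z).toLinearMap.codRestrict X.domain
      (fun y => ((unboundedResolvent_spec hz).1 y).choose)
  cont := by
    have key : ∀ y, X ⟨unboundedResolvent X z y, ((unboundedResolvent_spec hz).1 y).choose⟩ =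
        z • unboundedResolvent X z y - y := by
      intro y
      have h := ((unboundedResolvent_spec hz).1 y).choose_spec
      rw [eq_sub_iff_add_eq, add_comm]
      exact (sub_eq_iff_eq_add.1 h).symm
    have hc : Continuous fun y => z • unboundedResolvent X z y - y := by fun_prop
    exact hc.congr fun y => (key y).symm

end Unbounded

/-! ### Finite-dimensional compressions -/

section Compression

variable {H : Type*} [NormedAddCommGroup H] [InnerProductSpace ℂ H]

/-- `Range(P_n)`, the span of the first `n` basis vectors `e 0, …, e (n-1)`. -/
def basisSpan (e : HilbertBasis ℕ ℂ H) (n : ℕ) : Submodule ℂ H :=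
  Submodule.span ℂ (e '' Set.Iio n)

instance basisSpan_finiteDimensional (e : HilbertBasis ℕ ℂ H) (n : ℕ) :
    FiniteDimensional ℂ (basisSpan e n) :=
  FiniteDimensional.span_of_finite ℂ ((Set.finite_Iio n).image e)

theorem basisSpan_le_domain {e : HilbertBasis ℕ ℂ H} {X : H →ₗ.[ℂ] H}
    (he : ∀ k, e k ∈ X.domain) (n : ℕ) : basisSpan e n ≤ X.domain := by
  refine Submodule.span_le.2 ?_
  rintro _ ⟨k, _, rfl⟩
  exact he k

/-- The compression `x ↦ P_n X x`, acting on the space `Range(P_n)`. -/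
def compression (e : HilbertBasis ℕ ℂ H) (X : H →ₗ.[ℂ] H) (he : ∀ k, e k ∈ X.domain) (n : ℕ) :
    basisSpan e n →L[ℂ] basisSpan e n :=
  LinearMap.toContinuousLinearMap
    ((basisSpan e n).orthogonalProjectionOnto.toLinearMap ∘ₗ X.toFun ∘ₗ
      Submodule.inclusion (basisSpan_le_domain he n))

/-- The compression `P_n X P_n` as a bounded operator on the whole space. -/
def fullCompression (e : HilbertBasis ℕ ℂ H) (X : H →ₗ.[ℂ] H) (he : ∀ k, e k ∈ X.domain) (n : ℕ) :
    H →L[ℂ] H :=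
  (basisSpan e n).subtypeL ∘L compression e X he n ∘L (basisSpan e n).orthogonalProjectionOnto

/-- The bounded operator `(X_n - X) (z - X)⁻¹`, for `z ∈ ρ(X)`. -/
def compressionError (e : HilbertBasis ℕ ℂ H) (X : H →ₗ.[ℂ] H) (he : ∀ k, e k ∈ X.domain)
    (z : ℂ) (hz : z ∈ unboundedResolventSet X) (n : ℕ) : H →L[ℂ] H :=
  fullCompression e X he n ∘L unboundedResolvent X z - mulResolvent X z hz

/-- Exponential decay of the off-diagonal matrix coefficients of `X` in the basis `e`. -/
def OffDiagonalDecay (e : HilbertBasis ℕ ℂ H) (X : H →ₗ.[ℂ] H) (he : ∀ k, e k ∈ X.domain) : Prop :=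
  ∃ C : ℝ, 0 < C ∧ ∃ α : ℝ, 0 < α ∧ ∀ j k : ℕ, j ≠ k →
    ‖inner ℂ (e j) (X ⟨e k, he k⟩)‖ ≤ C * Real.exp (-α * |(j : ℝ) - k|)

end Compression

end

/-! Write `R(z) = (z - X)⁻¹`. Both parts come from convergence of `(z - X_n)⁻¹` to `R(z)` on the
contour, integrated against `f`. Admissibility asks that the spectrum avoid the closed set `K`
formed by the contour and the points of wrong index. Either `K` is compact or `X` is everywhere
defined, hence bounded; in both cases `(w - X) R(z) = 1 + (w - z) R(z)` is bounded uniformly on `K`,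
so smallness at one point `w` spreads to all of `K`.

Norm convergence: `(z - X_n) R(z) = 1 - F` with `F = (X_n - X) R(z) = (X_n - X) R(z₀) (1 + (z₀ - z)
R(z))`. Under (B1) this is uniformly small on `K`, a Neumann series inverts `1 - F`, and the
resolvents differ by `(z - X_n)⁻¹ F`.

Strong convergence: for `x` in `Range(P_n)`, with `Q = 1 - P_n`, `x = R(z) (z - X_n) x - (R(z) Q) (Q
X x)`. Off-diagonal decay bounds `Q X P_n` uniformly in `n`, and compactness gives `‖R(z) Q‖ → 0`.
So `z - X_n` is bounded below (`norm_le_of_compression`), hence invertible in finite dimension. The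
core condition makes the vectors `(z - X) x`, `x` in some `Range(P_m)`, dense; on them the
compressed resolvents are eventually exact. Uniform bounds and dominated convergence finish. -/

/-! ### Contour integrals and the index -/

namespace Contour

variable {E : Type*} [NormedAddCommGroup E] [NormedSpace ℂ E]

theorem arc_mem_image (Γ : Contour) (i : Fin Γ.size) {t : ℝ} (ht : t ∈ Set.Icc (0 : ℝ) 1) :
    Γ.arc i t ∈ Γ.image :=
  Set.mem_iUnion.2 ⟨i, t, ht, rfl⟩

theorem isCompact_image (Γ : Contour) : IsCompact Γ.image :=
  isCompact_iUnion fun i => isCompact_Icc.image_of_continuousOn (Γ.smooth i).continuousOn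

theorem continuousOn_derivWithin_arc (Γ : Contour) (i : Fin Γ.size) :
    ContinuousOn (derivWithin (Γ.arc i) (Set.Icc 0 1)) (Set.Icc 0 1) :=
  (Γ.smooth i).continuousOn_derivWithin (uniqueDiffOn_Icc zero_lt_one) le_rfl

theorem continuousOn_integrand (Γ : Contour) {g : ℂ → E} (hg : ContinuousOn g Γ.image)
    (i : Fin Γ.size) :
    ContinuousOn (fun t => derivWithin (Γ.arc i) (Set.Icc 0 1) t • g (Γ.arc i t))
      (Set.Icc 0 1) :=
  (Γ.continuousOn_derivWithin_arc i).smul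
    (hg.comp (Γ.smooth i).continuousOn fun _ ht => Γ.arc_mem_image i ht)

theorem intervalIntegrable_integrand (Γ : Contour) {g : ℂ → E} (hg : ContinuousOn g Γ.image)
    (i : Fin Γ.size) :
    IntervalIntegrable (fun t => derivWithin (Γ.arc i) (Set.Icc 0 1) t • g (Γ.arc i t))
      MeasureTheory.volume 0 1 :=
  (Γ.continuousOn_integrand hg i).intervalIntegrable_of_Icc zero_le_one

theorem integral_sub (Γ : Contour) {g h : ℂ → E} (hg : ContinuousOn g Γ.image)
    (hh : ContinuousOn h Γ.image) :
    Γ.integral (fun z => g z - h z) = Γ.integral g - Γ.integral h := by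
  simp only [integral, smul_sub]
  rw [← Finset.sum_sub_distrib]
  exact Finset.sum_congr rfl fun i _ => intervalIntegral.integral_sub
    (Γ.intervalIntegrable_integrand hg i) (Γ.intervalIntegrable_integrand hh i)

theorem clm_integral_comm [CompleteSpace E] {F : Type*} [NormedAddCommGroup F] [NormedSpace ℂ F]
    [CompleteSpace F] (Γ : Contour) (L : E →L[ℂ] F) {g : ℂ → E} (hg : ContinuousOn g Γ.image) :
    L (Γ.integral g) = Γ.integral (fun z => L (g z)) := by
  simp only [integral, map_sum]
  refine Finset.sum_congr rfl fun i _ => ?_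
  rw [← L.intervalIntegral_comp_comm (Γ.intervalIntegrable_integrand hg i)]
  simp only [map_smul]

/-- A bound for the total length of the contour. -/
theorem exists_norm_integral_le (Γ : Contour) :
    ∃ l : ℝ, 0 ≤ l ∧ ∀ (E : Type _) [NormedAddCommGroup E] [NormedSpace ℂ E] (g : ℂ → E) (b : ℝ),
      (∀ z ∈ Γ.image, ‖g z‖ ≤ b) → ‖Γ.integral g‖ ≤ l * b := by
  have h : ∀ i, ∃ d : ℝ, 0 ≤ d ∧
      ∀ t ∈ Set.Icc (0 : ℝ) 1, ‖derivWithin (Γ.arc i) (Set.Icc 0 1) t‖ ≤ d := by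
    intro i
    obtain ⟨d, hd⟩ := isCompact_Icc.exists_bound_of_continuousOn (Γ.continuousOn_derivWithin_arc i)
    exact ⟨d, (norm_nonneg _).trans (hd 0 (by simp)), hd⟩
  choose d hd0 hd using h
  refine ⟨∑ i, d i, Finset.sum_nonneg fun i _ => hd0 i, fun E _ _ g b hb => ?_⟩
  rw [Finset.sum_mul]
  refine (norm_sum_le _ _).trans (Finset.sum_le_sum fun i _ => ?_)
  have := intervalIntegral.norm_integral_le_of_norm_le_const (a := (0 : ℝ)) (b := 1)
    (C := d i * b) (f := fun t => derivWithin (Γ.arc i) (Set.Icc 0 1) t • g (Γ.arc i t)) ?_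
  · simpa using this
  · intro t ht
    rw [Set.uIoc_of_le zero_le_one] at ht
    have ht' := Set.Ioc_subset_Icc_self ht
    rw [norm_smul]
    exact mul_le_mul (hd i t ht') (hb _ (Γ.arc_mem_image i ht')) (norm_nonneg _) (hd0 i)

/-- Dominated convergence for contour integrals. -/
theorem tendsto_integral {Γ : Contour} {g : ℕ → ℂ → E} {g' : ℂ → E} {b : ℝ}
    (hg : ∀ᶠ n in atTop, ContinuousOn (g n) Γ.image)
    (hb : ∀ᶠ n in atTop, ∀ z ∈ Γ.image, ‖g n z‖ ≤ b)
    (hlim : ∀ z ∈ Γ.image, Tendsto (fun n => g n z) atTop (𝓝 (g' z))) :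
    Tendsto (fun n => Γ.integral (g n)) atTop (𝓝 (Γ.integral g')) := by
  refine tendsto_finsetSum _ fun i _ => ?_
  obtain ⟨d, hd⟩ := isCompact_Icc.exists_bound_of_continuousOn (Γ.continuousOn_derivWithin_arc i)
  have hsub : ∀ {t : ℝ}, t ∈ Set.uIoc (0 : ℝ) 1 → t ∈ Set.Icc (0 : ℝ) 1 := by
    intro t ht
    rw [Set.uIoc_of_le zero_le_one] at ht
    exact Set.Ioc_subset_Icc_self ht
  refine intervalIntegral.tendsto_integral_filter_of_dominated_convergence (fun _ => d * b)
    ?_ ?_ (by simp) ?_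
  · filter_upwards [hg] with n hn
    have := (Γ.intervalIntegrable_integrand hn i).aestronglyMeasurable
    rwa [Set.uIoc_of_le zero_le_one]
  · filter_upwards [hb] with n hn
    refine Eventually.of_forall fun t ht => ?_
    rw [norm_smul]
    exact mul_le_mul (hd t (hsub ht)) (hn _ (Γ.arc_mem_image i (hsub ht))) (norm_nonneg _)
      ((norm_nonneg _).trans (hd t (hsub ht)))
  · refine Eventually.of_forall fun t ht => ?_
    exact (hlim _ (Γ.arc_mem_image i (hsub ht))).const_smul _

/-- The integral along a closed contour of a function with a primitive vanishes. -/
theorem integral_eq_zero_of_hasDerivAt (Γ : Contour) {G g : ℂ → ℂ}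
    (hG : ∀ z ∈ Γ.image, HasDerivAt G (g z) z) (hg : ContinuousOn g Γ.image) :
    Γ.integral g = 0 := by
  have key : ∀ i, ∫ t in (0 : ℝ)..1, derivWithin (Γ.arc i) (Set.Icc 0 1) t • g (Γ.arc i t) =
      G (Γ.arc i 1) - G (Γ.arc i 0) := by
    intro i
    have hc : ContinuousOn (G ∘ Γ.arc i) (Set.Icc 0 1) := by
      refine ContinuousOn.comp (t := Γ.image) (fun z hz => ?_) (Γ.smooth i).continuousOn
        fun t ht => Γ.arc_mem_image i ht
      exact (hG z hz).continuousAt.continuousWithinAt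
    refine intervalIntegral.integral_eq_sub_of_hasDerivAt_of_le zero_le_one hc ?_
      (Γ.intervalIntegrable_integrand hg i)
    intro t ht
    have ht' := Set.Ioo_subset_Icc_self ht
    have h1 : HasDerivAt (Γ.arc i) (derivWithin (Γ.arc i) (Set.Icc 0 1) t) t :=
      (((Γ.smooth i).differentiableOn one_ne_zero t ht').hasDerivWithinAt).hasDerivAt
        (Icc_mem_nhds ht.1 ht.2)
    have := (hG _ (Γ.arc_mem_image i ht')).scomp t h1
    simpa using this
  -- Each arc ends where `next` starts, so the boundary values cancel after reindexing by the
  -- permutation.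
  simp only [integral, key, Γ.closed, Finset.sum_sub_distrib]
  rw [sub_eq_zero]
  exact Equiv.sum_comp Γ.next fun i => G (Γ.arc i 0)

theorem continuousOn_inv_sub (Γ : Contour) {z : ℂ} (hz : z ∉ Γ.image) :
    ContinuousOn (fun ζ => (ζ - z)⁻¹) Γ.image := by
  refine ContinuousOn.inv₀ (by fun_prop) fun ζ hζ h => hz ?_
  rwa [← sub_eq_zero.1 h]

/-- The index does not change under a displacement smaller than the distance to the contour. -/
theorem index_eq_of_forall_lt (Γ : Contour) {z w : ℂ} (h : ∀ ζ ∈ Γ.image, ‖z - w‖ < ‖ζ - z‖) :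
    Γ.index w = Γ.index z := by
  have hz : ∀ ζ ∈ Γ.image, ζ - z ≠ 0 := fun ζ hζ =>
    norm_pos_iff.1 ((norm_nonneg _).trans_lt (h ζ hζ))
  have hw : ∀ ζ ∈ Γ.image, ζ - w ≠ 0 := by
    intro ζ hζ h0
    have := h ζ hζ
    rw [← sub_eq_zero.1 h0, norm_sub_rev] at this
    exact lt_irrefl _ this
  have hz' : z ∉ Γ.image := fun h' => hz z h' (sub_self z)
  have hw' : w ∉ Γ.image := fun h' => hw w h' (sub_self w)
  have key : Γ.integral (fun ζ => (ζ - w)⁻¹ - (ζ - z)⁻¹) = 0 := by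
    -- The quotient is `1 + (z - w) / (ζ - z)`, within distance less than `1` of `1`, so the
    -- principal logarithm is holomorphic there.
    refine Γ.integral_eq_zero_of_hasDerivAt (G := fun ζ => Complex.log ((ζ - w) / (ζ - z)))
      (fun ζ hζ => ?_) ((Γ.continuousOn_inv_sub hw').sub (Γ.continuousOn_inv_sub hz'))
    have hs : (ζ - w) / (ζ - z) ∈ Complex.slitPlane := by
      have h1 : (ζ - w) / (ζ - z) = 1 + (z - w) / (ζ - z) := by
        have := hz ζ hζ
        field_simp
        ring
      rw [h1]
      refine Complex.mem_slitPlane_of_norm_lt_one ?_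
      rw [norm_div, div_lt_one (norm_pos_iff.2 (hz ζ hζ))]
      exact h ζ hζ
    have hd : HasDerivAt (fun ζ : ℂ => (ζ - w) / (ζ - z))
        ((1 * (ζ - z) - (ζ - w) * 1) / (ζ - z) ^ 2) ζ :=
      ((hasDerivAt_id ζ).sub_const w).fun_div ((hasDerivAt_id ζ).sub_const z) (hz ζ hζ)
    convert hd.clog hs using 1
    have h1 := hz ζ hζ
    have h2 := hw ζ hζ
    field_simp
  rw [Γ.integral_sub (Γ.continuousOn_inv_sub hw') (Γ.continuousOn_inv_sub hz'), sub_eq_zero] at key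
  rw [index, index, key]

/-- The index vanishes off a bounded set. -/
theorem exists_index_eq_zero (Γ : Contour) : ∃ r : ℝ, ∀ z : ℂ, r < ‖z‖ → Γ.index z = 0 := by
  obtain ⟨r, hr⟩ := Γ.isCompact_image.isBounded.exists_norm_le
  -- For an empty contour `r` may be negative; the maximum still forces `z ≠ 0`.
  refine ⟨max r 0, fun z hz => ?_⟩
  have hz0 : z ≠ 0 := norm_pos_iff.1 ((le_max_right _ _).trans_lt hz)
  have hlt : ∀ ζ ∈ Γ.image, ‖ζ‖ < ‖z‖ := fun ζ hζ =>
    (hr ζ hζ).trans_lt ((le_max_left _ _).trans_lt hz)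
  have hz' : z ∉ Γ.image := fun h => lt_irrefl _ (hlt z h)
  have key : Γ.integral (fun ζ => (ζ - z)⁻¹) = 0 := by
    refine Γ.integral_eq_zero_of_hasDerivAt (G := fun ζ => Complex.log (1 + -ζ / z))
      (fun ζ hζ => ?_) (Γ.continuousOn_inv_sub hz')
    have hs : 1 + -ζ / z ∈ Complex.slitPlane := by
      refine Complex.mem_slitPlane_of_norm_lt_one ?_
      rw [norm_div, norm_neg, div_lt_one (norm_pos_iff.2 hz0)]
      exact hlt ζ hζ
    have hd : HasDerivAt (fun ζ : ℂ => 1 + -ζ / z) (-1 / z) ζ :=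
      ((hasDerivAt_neg ζ).div_const z).const_add 1
    convert hd.clog hs using 1
    have h1 : ζ - z ≠ 0 := fun h => hz' (by rwa [← sub_eq_zero.1 h])
    have h2 : 1 + -ζ / z ≠ 0 := Complex.slitPlane_ne_zero hs
    rw [inv_eq_iff_eq_inv, inv_div]
    field_simp
    ring
  rw [index, key, mul_zero]

/-- The set of points off the contour at which the index has a given value is open (stated for the
complement). -/
theorem isClosed_image_union_index_ne (Γ : Contour) (a : ℂ) :
    IsClosed (Γ.image ∪ {z | Γ.index z ≠ a}) := by
  rw [← isOpen_compl_iff, Metric.isOpen_iff]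
  intro z hz
  simp only [Set.mem_compl_iff, Set.mem_union, Set.mem_ofPred_eq, not_or, not_not] at hz
  obtain ⟨ε, hε, hball⟩ := Metric.isOpen_iff.1 Γ.isCompact_image.isClosed.isOpen_compl z hz.1
  refine ⟨ε, hε, fun w hw => ?_⟩
  simp only [Set.mem_compl_iff, Set.mem_union, Set.mem_ofPred_eq, not_or, not_not]
  refine ⟨hball hw, ?_⟩
  rw [Γ.index_eq_of_forall_lt (z := z), hz.2]
  intro ζ hζ
  refine lt_of_lt_of_le (b := ε) ?_ ?_
  · rw [norm_sub_rev, ← dist_eq_norm]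
    exact hw
  · by_contra! h
    rw [← dist_eq_norm] at h
    exact hball h hζ

/-- Admissibility only asks that the spectrum avoids a closed set `K` which contains the contour;
`K` is compact unless the operator is everywhere defined. -/
theorem Admissible.exists_closed {Γ : Contour} {f : ℂ → ℂ} {c : ℂ} {U S : Set ℂ} {P : Prop}
    (h : Γ.Admissible f c U S P) :
    Γ.image ⊆ U ∧ ∃ K : Set ℂ, IsClosed K ∧ Γ.image ⊆ K ∧ Disjoint K S ∧ (IsCompact K ∨ P) ∧
      ∀ S' : Set ℂ, Disjoint K S' → Γ.Admissible f c U S' True := by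
  have aux : ∀ a : ℂ, Γ.image ⊆ U \ S → (∀ z ∈ S, Γ.index z = a) →
      Disjoint (Γ.image ∪ {z | Γ.index z ≠ a}) S := by
    intro a h1 h2
    rw [Set.disjoint_left]
    rintro z (hz | hz) hzS
    · exact (h1 hz).2 hzS
    · exact hz (h2 z hzS)
  have aux' : ∀ (a : ℂ) (S' : Set ℂ), Γ.image ⊆ U →
      Disjoint (Γ.image ∪ {z | Γ.index z ≠ a}) S' →
      Γ.image ⊆ U \ S' ∧ ∀ z ∈ S', Γ.index z = a := by
    intro a S' h1 hd
    rw [Set.disjoint_left] at hd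
    refine ⟨fun z hz => ⟨h1 hz, hd (Or.inl hz)⟩, fun z hz => ?_⟩
    by_contra hne
    exact hd (Or.inr hne) hz
  -- `K` is the contour together with the points of index different from `1`, respectively `0`. In
  -- the second case `K` is bounded because the index vanishes near infinity.
  rcases h with ⟨hP, ⟨h1, h2, h3⟩, hc⟩ | ⟨⟨h1, h2, h3⟩, hc⟩
  · have hU : Γ.image ⊆ U := fun z hz => (h1 hz).1
    refine ⟨hU, _, Γ.isClosed_image_union_index_ne 1, Set.subset_union_left, aux 1 h1 h2,
      Or.inr hP, fun S' hS' => Or.inl ⟨trivial, ⟨?_, ?_, h3⟩, hc⟩⟩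
    · exact (aux' 1 S' hU hS').1
    · exact (aux' 1 S' hU hS').2
  · have hU : Γ.image ⊆ U := fun z hz => (h1 hz).1
    refine ⟨hU, _, Γ.isClosed_image_union_index_ne 0, Set.subset_union_left, aux 0 h1 h2,
      Or.inl ?_, fun S' hS' => Or.inr ⟨⟨?_, ?_, h3⟩, hc⟩⟩
    · refine Metric.isCompact_of_isClosed_isBounded (Γ.isClosed_image_union_index_ne 0) ?_
      obtain ⟨r, hr⟩ := Γ.exists_index_eq_zero
      refine Γ.isCompact_image.isBounded.union ((Metric.isBounded_closedBall (x := (0 : ℂ))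
        (r := r)).subset fun z hz => ?_)
      by_contra hne
      rw [mem_closedBall_zero_iff, not_le] at hne
      exact hz (hr z hne)
    · exact (aux' 0 S' hU hS').1
    · exact (aux' 0 S' hU hS').2

end Contour

/-! ### Resolvents of a closed operator -/

section Resolvent

variable {H : Type*} [NormedAddCommGroup H] [InnerProductSpace ℂ H] {X : H →ₗ.[ℂ] H}

theorem unboundedResolvent_mem_domain {z : ℂ} (hz : z ∈ unboundedResolventSet X) (y : H) :
    unboundedResolvent X z y ∈ X.domain :=
  ((unboundedResolvent_spec hz).1 y).choose

theorem apply_unboundedResolvent {z : ℂ} (hz : z ∈ unboundedResolventSet X) (y : H) :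
    X ⟨unboundedResolvent X z y, unboundedResolvent_mem_domain hz y⟩ =
      z • unboundedResolvent X z y - y := by
  have h := ((unboundedResolvent_spec hz).1 y).choose_spec
  rw [eq_sub_iff_add_eq, add_comm]
  exact (sub_eq_iff_eq_add.1 h).symm

theorem unboundedResolvent_apply_sub {z : ℂ} (hz : z ∈ unboundedResolventSet X) (x : X.domain) :
    unboundedResolvent X z (z • (x : H) - X x) = x :=
  (unboundedResolvent_spec hz).2 x

theorem mulResolvent_apply {z : ℂ} (hz : z ∈ unboundedResolventSet X) (y : H) :
    mulResolvent X z hz y = z • unboundedResolvent X z y - y :=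
  apply_unboundedResolvent hz y

/-- The first resolvent identity. -/
theorem unboundedResolvent_eq_comp {z w : ℂ} (hz : z ∈ unboundedResolventSet X)
    (hw : w ∈ unboundedResolventSet X) :
    unboundedResolvent X z =
      unboundedResolvent X w ∘L (1 + (w - z) • unboundedResolvent X z) := by
  ext y
  have h := unboundedResolvent_apply_sub hw ⟨_, unboundedResolvent_mem_domain hz y⟩
  rw [apply_unboundedResolvent hz] at h
  refine h.symm.trans ?_
  simp only [ContinuousLinearMap.comp_apply, add_apply,
    one_apply_eq_self, smul_apply]
  congr 1
  module

theorem norm_unboundedResolvent_sub_le {z w : ℂ} (hz : z ∈ unboundedResolventSet X)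
    (hw : w ∈ unboundedResolventSet X) :
    ‖unboundedResolvent X z - unboundedResolvent X w‖ ≤
      ‖w - z‖ * ‖unboundedResolvent X w‖ * ‖unboundedResolvent X z‖ := by
  have h : unboundedResolvent X z - unboundedResolvent X w =
      (w - z) • (unboundedResolvent X w ∘L unboundedResolvent X z) := by
    conv_lhs => rw [unboundedResolvent_eq_comp hz hw]
    ext y
    simp
  rw [h, norm_smul, mul_assoc]
  gcongr
  exact ContinuousLinearMap.opNorm_comp_le _ _

/-- The resolvent identity estimates the difference by `‖w - z‖ ‖R(w)‖ ‖R(z)‖`. Once `‖w - z‖ ‖R(w)‖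
< 1/2`, absorbing the last factor gives `‖R(z)‖ ≤ 2 ‖R(w)‖`. -/
theorem continuousOn_unboundedResolvent (X : H →ₗ.[ℂ] H) :
    ContinuousOn (unboundedResolvent X) (unboundedResolventSet X) := by
  intro w hw
  set b := ‖unboundedResolvent X w‖ with hb
  have hlim : Tendsto (fun z : ℂ => ‖w - z‖ * b * (2 * b))
      (𝓝[unboundedResolventSet X] w) (𝓝 0) := by
    have : Continuous fun z : ℂ => ‖w - z‖ * b * (2 * b) := by fun_prop
    have h := this.tendsto w
    simp only [sub_self, norm_zero, zero_mul] at h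
    exact h.mono_left nhdsWithin_le_nhds
  have hsmall : ∀ᶠ z in 𝓝[unboundedResolventSet X] w, ‖w - z‖ * b < 1 / 2 := by
    have : Continuous fun z : ℂ => ‖w - z‖ * b := by fun_prop
    have h := this.tendsto w
    simp only [sub_self, norm_zero, zero_mul] at h
    exact (h.mono_left nhdsWithin_le_nhds).eventually_lt_const (by norm_num)
  rw [ContinuousWithinAt, tendsto_iff_norm_sub_tendsto_zero]
  refine squeeze_zero' (Eventually.of_forall fun _ => norm_nonneg _) ?_ hlim
  filter_upwards [hsmall, self_mem_nhdsWithin] with z hz hzρ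
  have h1 := norm_unboundedResolvent_sub_le hzρ hw
  have h2 : ‖unboundedResolvent X z‖ ≤ 2 * b := by
    have h3 := norm_le_norm_add_norm_sub' (unboundedResolvent X z) (unboundedResolvent X w)
    have h4 : ‖w - z‖ * b * ‖unboundedResolvent X z‖ ≤ 1 / 2 * ‖unboundedResolvent X z‖ := by
      gcongr
    linarith
  exact h1.trans (by gcongr)

/-- The closed graph theorem for an everywhere defined closed operator. -/
theorem LinearPMap.IsClosed.exists_clm_of_domain_eq_top [CompleteSpace H] (hX : X.IsClosed)
    (hdom : X.domain = ⊤) : ∃ T : H →L[ℂ] H, ∀ x : X.domain, X x = T x := by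
  let T : H →ₗ[ℂ] H := X.toFun ∘ₗ (LinearEquiv.ofTop _ hdom).symm.toLinearMap
  have hT : ∀ x : X.domain, X x = T x := fun x => rfl
  refine ⟨⟨T, T.continuous_of_isClosed_graph ?_⟩, hT⟩
  have hgraph : T.graph = X.graph := by
    ext ⟨x, y⟩
    simp only [LinearMap.mem_graph_iff, LinearPMap.mem_graph_iff]
    constructor
    · rintro rfl
      exact ⟨⟨x, hdom ▸ Submodule.mem_top⟩, rfl, hT _⟩
    · rintro ⟨x, rfl, rfl⟩
      exact hT x
  rw [hgraph]
  exact hX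

/-- The operators `(w - X) (z - X)⁻¹` are uniformly bounded for `z` in a closed subset of the
resolvent set, provided that this subset is compact or that `X` is everywhere defined. -/
theorem exists_norm_one_add_smul_unboundedResolvent_le [CompleteSpace H] (hX : X.IsClosed)
    {K : Set ℂ} (hK : IsClosed K) (hKX : K ⊆ unboundedResolventSet X)
    (hcase : IsCompact K ∨ X.domain = ⊤) (w : ℂ) :
    ∃ A : ℝ, 0 < A ∧ ∀ z ∈ K, ‖1 + (w - z) • unboundedResolvent X z‖ ≤ A := by
  have hcpt : ∀ K' ⊆ K, IsCompact K' →
      ∃ A : ℝ, ∀ z ∈ K', ‖1 + (w - z) • unboundedResolvent X z‖ ≤ A := by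
    intro K' hK' hc
    refine hc.exists_bound_of_continuousOn ?_
    exact continuousOn_const.add ((continuousOn_const.sub continuousOn_id).smul
      ((continuousOn_unboundedResolvent X).mono (hK'.trans hKX)))
  rcases hcase with hc | hdom
  · obtain ⟨A, hA⟩ := hcpt K subset_rfl hc
    exact ⟨max A 1, by positivity, fun z hz => (hA z hz).trans (le_max_left _ _)⟩
  · obtain ⟨T, hT⟩ := hX.exists_clm_of_domain_eq_top hdom
    -- For `‖z‖ > r`, the identity `z R(z) = 1 + R(z) T` and `2 ‖T‖ ≤ ‖z‖` give `‖z‖ ‖R(z)‖ ≤ 2`;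
    -- the `+ 1` permits division by `r`. The rest of `K` is compact.
    set r : ℝ := 2 * ‖T‖ + 1 with hr
    have hr0 : 0 < r := by positivity
    obtain ⟨A, hA⟩ := hcpt (K ∩ Metric.closedBall 0 r) Set.inter_subset_left
      ((isCompact_closedBall _ _).inter_left hK)
    refine ⟨max A (1 + (‖w‖ / r + 1) * 2), lt_max_of_lt_right (by positivity), fun z hz => ?_⟩
    rcases le_or_gt ‖z‖ r with hzr | hzr
    · exact (hA z ⟨hz, mem_closedBall_zero_iff.2 hzr⟩).trans (le_max_left _ _)
    refine le_trans ?_ (le_max_right _ _)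
    have h1 : z • unboundedResolvent X z = 1 + unboundedResolvent X z ∘L T := by
      ext x
      have h := unboundedResolvent_apply_sub (hKX hz) ⟨x, hdom ▸ Submodule.mem_top⟩
      rw [hT, map_sub, map_smul, sub_eq_iff_eq_add] at h
      simpa using h
    have h2 : ‖z‖ * ‖unboundedResolvent X z‖ ≤ 1 + ‖unboundedResolvent X z‖ * ‖T‖ := by
      rw [← norm_smul, h1]
      refine (norm_add_le _ _).trans (add_le_add ?_ (ContinuousLinearMap.opNorm_comp_le _ _))
      exact ContinuousLinearMap.norm_id_le
    have h3 : ‖z‖ * ‖unboundedResolvent X z‖ ≤ 2 := by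
      have : ‖unboundedResolvent X z‖ * (2 * ‖T‖) ≤ ‖unboundedResolvent X z‖ * ‖z‖ := by
        gcongr
        linarith
      linarith
    have h4 : ‖w - z‖ ≤ (‖w‖ / r + 1) * ‖z‖ := by
      refine (norm_sub_le _ _).trans ?_
      rw [add_mul, one_mul]
      gcongr
      rw [div_mul_eq_mul_div, le_div_iff₀ hr0]
      gcongr
    calc ‖1 + (w - z) • unboundedResolvent X z‖
        ≤ 1 + ‖w - z‖ * ‖unboundedResolvent X z‖ := by
          refine (norm_add_le _ _).trans (add_le_add ContinuousLinearMap.norm_id_le ?_)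
          rw [norm_smul]
      _ ≤ 1 + (‖w‖ / r + 1) * ‖z‖ * ‖unboundedResolvent X z‖ := by gcongr
      _ ≤ 1 + (‖w‖ / r + 1) * 2 := by
          rw [mul_assoc]
          gcongr

end Resolvent

/-! ### The Dunford–Taylor integral -/

section DunfordTaylor

variable {E : Type*} [NormedAddCommGroup E] [NormedSpace ℂ E]

theorem continuousOn_resolvent [CompleteSpace E] {T : E →L[ℂ] E} {K : Set ℂ}
    (hK : Disjoint K (spectrum ℂ T)) : ContinuousOn (resolvent T) K := by
  intro z hz
  have : z ∈ resolventSet ℂ T := not_not.1 (Set.disjoint_left.1 hK hz)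
  exact (spectrum.hasDerivAt_resolvent_const_left this).continuousAt.continuousWithinAt

theorem dunfordTaylor_apply [CompleteSpace E] {f : ℂ → ℂ} {Γ : Contour}
    (hf : ContinuousOn f Γ.image) (c : ℂ) {R : ℂ → E →L[ℂ] E} (hR : ContinuousOn R Γ.image)
    (u : E) : dunfordTaylor f c Γ R u =
      c • u + (2 * Real.pi * Complex.I : ℂ)⁻¹ • Γ.integral (fun z => f z • R z u) := by
  have h := Γ.clm_integral_comm (ContinuousLinearMap.apply ℂ E u) (hf.fun_smul hR)
  simp only [ContinuousLinearMap.apply_apply, smul_apply] at h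
  simp [dunfordTaylor, h]

theorem dunfordTaylor_sub {f : ℂ → ℂ} {Γ : Contour} (hf : ContinuousOn f Γ.image) (c : ℂ)
    {R S : ℂ → E →L[ℂ] E} (hR : ContinuousOn R Γ.image) (hS : ContinuousOn S Γ.image) :
    dunfordTaylor f c Γ R - dunfordTaylor f c Γ S =
      (2 * Real.pi * Complex.I : ℂ)⁻¹ • Γ.integral (fun z => f z • (R z - S z)) := by
  simp only [smul_sub]
  rw [Γ.integral_sub (hf.fun_smul hR) (hf.fun_smul hS), smul_sub]
  simp [dunfordTaylor]

end DunfordTaylor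

/-! ### Norm convergence -/

section NormConvergence

variable {H : Type*} [NormedAddCommGroup H] [InnerProductSpace ℂ H] {X : H →ₗ.[ℂ] H}

/-- If `(T - X) (z - X)⁻¹` is a strict contraction, then `z` is in the resolvent set of the
bounded operator `T`. -/
theorem notMem_spectrum_of_norm_lt_one [CompleteSpace H] (hdense : Dense (X.domain : Set H))
    {z : ℂ} (hz : z ∈ unboundedResolventSet X) {T F : H →L[ℂ] H}
    (hF : ∀ y, F y = T (unboundedResolvent X z y) - (z • unboundedResolvent X z y - y))
    (hF1 : ‖F‖ < 1) :
    z ∉ spectrum ℂ T ∧ resolvent T z * (1 - F) = unboundedResolvent X z := by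
  have h1 : (algebraMap ℂ (H →L[ℂ] H) z - T) * unboundedResolvent X z = 1 - F := by
    ext y
    simp only [mul_apply_eq_comp, sub_apply, hF,
      ContinuousLinearMap.algebraMap_apply, one_apply_eq_self]
    abel
  obtain ⟨V, hV⟩ := isUnit_one_sub_of_norm_lt_one hF1
  have hright : (algebraMap ℂ (H →L[ℂ] H) z - T) * (unboundedResolvent X z * ↑V⁻¹) = 1 := by
    rw [← mul_assoc, h1, ← hV, Units.mul_inv]
  -- For `x` in the dense domain and `y = (z - X) x`, one has `(z - T) x = (z - T) R(z) y = V y`,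
  -- hence `R(z) V⁻¹ (z - T) x = R(z) y = x`.
  have hleft : (unboundedResolvent X z * ↑V⁻¹) * (algebraMap ℂ (H →L[ℂ] H) z - T) = 1 := by
    refine ContinuousLinearMap.coeFn_injective (Continuous.ext_on hdense
      (ContinuousLinearMap.continuous _) (ContinuousLinearMap.continuous _) fun x hx => ?_)
    have h2 := unboundedResolvent_apply_sub hz ⟨x, hx⟩
    have h3 := congrArg (fun S : H →L[ℂ] H => S (z • x - X ⟨x, hx⟩)) h1
    simp only [mul_apply_eq_comp, ← hV] at h3
    rw [h2] at h3
    have h4 := congrArg (fun S : H →L[ℂ] H => S (z • x - X ⟨x, hx⟩)) V.inv_mul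
    simp only [mul_apply_eq_comp, one_apply_eq_self] at h4
    simp only [mul_apply_eq_comp, one_apply_eq_self]
    rw [h3, h4, h2]
  have hunit : IsUnit (algebraMap ℂ (H →L[ℂ] H) z - T) := ⟨⟨_, _, hright, hleft⟩, rfl⟩
  refine ⟨fun h => h hunit, ?_⟩
  rw [← h1, ← mul_assoc, resolvent, Ring.inverse_mul_cancel _ hunit, one_mul]

variable {e : HilbertBasis ℕ ℂ H} {he : ∀ k, e k ∈ X.domain}

/-- Transfers (B1) from the fixed point `w` to any `z`: by the resolvent identity the composition is
`(X_n - X) R(z)`, the operator `F` of `notMem_spectrum_of_norm_lt_one`. -/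
theorem compressionError_comp_apply {z w : ℂ} (hz : z ∈ unboundedResolventSet X)
    (hw : w ∈ unboundedResolventSet X) (n : ℕ) (y : H) :
    (compressionError e X he w hw n ∘L (1 + (w - z) • unboundedResolvent X z)) y =
      fullCompression e X he n (unboundedResolvent X z y) -
        (z • unboundedResolvent X z y - y) := by
  have h := congrArg (fun S : H →L[ℂ] H => S y) (unboundedResolvent_eq_comp hz hw)
  simp only [ContinuousLinearMap.comp_apply] at h
  simp only [compressionError, ContinuousLinearMap.comp_apply, sub_apply,
    mulResolvent_apply, ← h]
  simp only [add_apply, one_apply_eq_self,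
    smul_apply]
  module

/-- Here `R - S = R F`, and absorbing `‖R F‖ ≤ ‖R‖ / 2` yields `‖R‖ ≤ 2 ‖S‖`. -/
theorem norm_resolvent_sub_le {A : Type*} [NormedRing A] {R S F : A} (h : R * (1 - F) = S)
    (hF : ‖F‖ ≤ 1 / 2) : ‖R - S‖ ≤ 2 * ‖S‖ * ‖F‖ := by
  have h1 : R - S = R * F := by
    rw [← h]
    noncomm_ring
  have h2 : ‖R - S‖ ≤ ‖R‖ * ‖F‖ := h1 ▸ norm_mul_le _ _
  have h3 : ‖R‖ ≤ ‖S‖ + ‖R - S‖ := norm_le_norm_add_norm_sub' _ _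
  have h4 : ‖R‖ * ‖F‖ ≤ ‖R‖ * (1 / 2) := by gcongr
  refine h2.trans ?_
  gcongr
  linarith

/-- The constant is fixed before the basis and `X`, so it may use only bounds on the contour and
`M`. The bound `A` over `K`, which depends on `X`, only decides how large `n` must be. -/
theorem norm_convergence [CompleteSpace H] {f : ℂ → ℂ} {U : Set ℂ} (hf : ContinuousOn f U)
    (Γ : Contour) (c : ℂ) (z₀ : ℂ) (M : ℝ) : ∃ C : ℝ, 0 < C ∧
      ∀ (e : HilbertBasis ℕ ℂ H) (X : H →ₗ.[ℂ] H) (he : ∀ k, e k ∈ X.domain),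
      X.IsClosed → Dense (X.domain : Set H) →
      Γ.Admissible f c U (unboundedSpectrum X) (X.domain = ⊤) →
      (∀ z ∈ Γ.image, ‖unboundedResolvent X z‖ ≤ M) →
      ∀ hz₀ : z₀ ∈ unboundedResolventSet X,
      Tendsto (fun n => ‖compressionError e X he z₀ hz₀ n‖) atTop (𝓝 0) →
      (∀ᶠ n in atTop, Γ.Admissible f c U (spectrum ℂ (fullCompression e X he n)) True) ∧
      ∀ᶠ n in atTop, ‖dunfordTaylor f c Γ (resolvent (fullCompression e X he n)) -
        dunfordTaylor f c Γ (unboundedResolvent X)‖ ≤ C * ‖compressionError e X he z₀ hz₀ n‖ := by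
  -- A contour leaving `U` is admissible for no operator, so any constant serves.
  by_cases hΓU : Γ.image ⊆ U
  swap
  · exact ⟨1, one_pos, fun e X he _ _ hadm => absurd hadm.exists_closed.1 hΓU⟩
  have hfΓ := hf.mono hΓU
  obtain ⟨l, hl0, hl⟩ := Γ.exists_norm_integral_le
  obtain ⟨b, hb⟩ := Γ.isCompact_image.exists_bound_of_continuousOn hfΓ
  obtain ⟨d, hd⟩ := Γ.isCompact_image.exists_bound_of_continuousOn
    (f := fun z => z₀ - z) (by fun_prop)
  -- Length times `sup |f|` times the resolvent difference `2 M (1 + d M)` per unit of error.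
  -- Absolute values guard against negative bounds; `κ + 1` below ensures positivity.
  set κ : ℝ := ‖(2 * Real.pi * Complex.I : ℂ)⁻¹‖ * (l * (|b| * (2 * |M| * (1 + |d| * |M|))))
  have hκ : 0 ≤ κ := by positivity
  refine ⟨κ + 1, by positivity, fun e X he hX hdense hadm hM hz₀ hlim => ?_⟩
  obtain ⟨-, K, hK, hΓK, hKX, hcase, hadm'⟩ := hadm.exists_closed
  have hKρ : K ⊆ unboundedResolventSet X := fun z hz =>
    not_not.1 (Set.disjoint_left.1 hKX hz)
  obtain ⟨A, hA0, hA⟩ :=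
    exists_norm_one_add_smul_unboundedResolvent_le hX hK hKρ hcase z₀
  have hev : ∀ᶠ n in atTop, ‖compressionError e X he z₀ hz₀ n‖ * A < 1 / 2 := by
    have h := hlim.mul_const A
    rw [zero_mul] at h
    exact h.eventually_lt_const (by norm_num)
  -- The last factor is not replaced by `A`: on the contour it is at most `1 + |d| |M|`, which is
  -- independent of `X`.
  have key : ∀ᶠ n in atTop, ∀ z ∈ K, z ∉ spectrum ℂ (fullCompression e X he n) ∧
      ‖resolvent (fullCompression e X he n) z - unboundedResolvent X z‖ ≤
        2 * ‖unboundedResolvent X z‖ * (‖compressionError e X he z₀ hz₀ n‖ *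
          ‖1 + (z₀ - z) • unboundedResolvent X z‖) := by
    filter_upwards [hev] with n hn z hz
    have hF1 : ‖compressionError e X he z₀ hz₀ n ∘L
        (1 + (z₀ - z) • unboundedResolvent X z)‖ ≤ ‖compressionError e X he z₀ hz₀ n‖ *
          ‖1 + (z₀ - z) • unboundedResolvent X z‖ := ContinuousLinearMap.opNorm_comp_le _ _
    have hF2 : ‖compressionError e X he z₀ hz₀ n‖ *
        ‖1 + (z₀ - z) • unboundedResolvent X z‖ ≤ 1 / 2 := by
      refine le_trans ?_ hn.le
      gcongr
      exact hA z hz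
    obtain ⟨h1, h2⟩ := notMem_spectrum_of_norm_lt_one hdense (hKρ hz)
      (compressionError_comp_apply (e := e) (he := he) (hKρ hz) hz₀ n)
      ((hF1.trans hF2).trans_lt (by norm_num))
    refine ⟨h1, (norm_resolvent_sub_le h2 (hF1.trans hF2)).trans ?_⟩
    gcongr
  have hdisj : ∀ᶠ n in atTop, Disjoint K (spectrum ℂ (fullCompression e X he n)) :=
    key.mono fun n hn => Set.disjoint_left.2 fun z hz => (hn z hz).1
  refine ⟨hdisj.mono fun n hn => hadm' _ hn, ?_⟩
  filter_upwards [key, hdisj] with n hn hdn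
  rw [dunfordTaylor_sub hfΓ c (continuousOn_resolvent (hdn.mono_left hΓK))
    ((continuousOn_unboundedResolvent X).mono (hΓK.trans hKρ)), norm_smul]
  set ε := ‖compressionError e X he z₀ hz₀ n‖
  have hpt : ∀ z ∈ Γ.image, ‖f z • (resolvent (fullCompression e X he n) z -
      unboundedResolvent X z)‖ ≤ |b| * (2 * |M| * (ε * (1 + |d| * |M|))) := by
    intro z hz
    have hMz : ‖unboundedResolvent X z‖ ≤ |M| := (hM z hz).trans (le_abs_self M)
    rw [norm_smul]
    refine mul_le_mul ((hb z hz).trans (le_abs_self b)) ((hn z (hΓK hz)).2.trans ?_)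
      (norm_nonneg _) (abs_nonneg _)
    gcongr
    refine (norm_add_le _ _).trans (add_le_add ContinuousLinearMap.norm_id_le ?_)
    rw [norm_smul]
    gcongr
    exact (hd z hz).trans (le_abs_self d)
  calc _ ≤ ‖(2 * Real.pi * Complex.I : ℂ)⁻¹‖ *
        (l * (|b| * (2 * |M| * (ε * (1 + |d| * |M|))))) := by
        gcongr
        exact hl _ _ _ hpt
    _ = κ * ε := by ring
    _ ≤ (κ + 1) * ε := by
        gcongr
        linarith

end NormConvergence

/-! ### Projections and compact operators -/

section Projections

variable {H : Type*} [NormedAddCommGroup H] [InnerProductSpace ℂ H]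

theorem basis_mem_basisSpan (e : HilbertBasis ℕ ℂ H) {k n : ℕ} (hk : k < n) :
    e k ∈ basisSpan e n :=
  Submodule.subset_span ⟨k, hk, rfl⟩

theorem basisSpan_mono (e : HilbertBasis ℕ ℂ H) : Monotone (basisSpan e) := fun _ _ h =>
  Submodule.span_mono (Set.image_mono (Set.Iio_subset_Iio h))

theorem inner_basis_eq_zero (e : HilbertBasis ℕ ℂ H) {k n : ℕ} (hk : n ≤ k) {x : H}
    (hx : x ∈ basisSpan e n) : inner ℂ (e k) x = 0 := by
  induction hx using Submodule.span_induction with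
  | mem x h =>
    obtain ⟨j, hj, rfl⟩ := h
    exact e.orthonormal.2 (lt_of_lt_of_le hj hk).ne'
  | zero => exact inner_zero_right _
  | add x y _ _ hx hy => rw [inner_add_right, hx, hy, add_zero]
  | smul a x _ hx => rw [inner_smul_right, hx, mul_zero]

theorem eq_sum_of_mem_basisSpan (e : HilbertBasis ℕ ℂ H) {n : ℕ} {x : H}
    (hx : x ∈ basisSpan e n) : x = ∑ k ∈ Finset.range n, inner ℂ (e k) x • e k := by
  have h := e.hasSum_repr x
  simp only [HilbertBasis.repr_apply_apply] at h
  refine h.unique (hasSum_sum_of_ne_finset_zero fun k hk => ?_)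
  rw [inner_basis_eq_zero e (by simpa using hk) hx, zero_smul]

theorem starProjection_basisSpan_tendsto [CompleteSpace H] (e : HilbertBasis ℕ ℂ H) (x : H) :
    Tendsto (fun n => (basisSpan e n).starProjection x) atTop (𝓝 x) := by
  refine Submodule.starProjection_tendsto_self _ (basisSpan_mono e) x ?_
  rw [← e.dense_span]
  refine Submodule.topologicalClosure_mono (Submodule.span_le.2 ?_)
  rintro _ ⟨k, rfl⟩
  exact Submodule.mem_iSup_of_mem (k + 1) (basis_mem_basisSpan e k.lt_succ_self)

/-- Operators which are uniformly bounded and converge on a dense set converge strongly. -/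
theorem tendsto_clm_of_dense {E F : Type*} [NormedAddCommGroup E] [NormedSpace ℂ E]
    [NormedAddCommGroup F] [NormedSpace ℂ F] {A : ℕ → E →L[ℂ] F} {B : E →L[ℂ] F} {b : ℝ}
    (hb : ∀ᶠ n in atTop, ‖A n‖ ≤ b) {D : Set E} (hD : Dense D)
    (h : ∀ u ∈ D, Tendsto (fun n => A n u) atTop (𝓝 (B u))) (u : E) :
    Tendsto (fun n => A n u) atTop (𝓝 (B u)) := by
  rw [Metric.tendsto_nhds]
  intro ε hε
  set m : ℝ := |b| + ‖B‖ + 1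
  have hm : 0 < m := by positivity
  obtain ⟨v, hvD, hv⟩ := Metric.dense_iff.1 hD u (ε / (2 * m)) (by positivity)
  rw [Metric.mem_ball, dist_eq_norm, norm_sub_rev] at hvD
  filter_upwards [hb, Metric.tendsto_nhds.1 (h v hv) (ε / 2) (by positivity)] with n hn hvn
  rw [dist_eq_norm] at hvn ⊢
  have h1 : A n u - B u = A n (u - v) - B (u - v) + (A n v - B v) := by
    simp only [map_sub]
    abel
  have h2 : ‖A n (u - v)‖ ≤ |b| * ‖u - v‖ :=
    (A n).le_of_opNorm_le (hn.trans (le_abs_self b)) _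
  have h3 : ‖B (u - v)‖ ≤ ‖B‖ * ‖u - v‖ := B.le_opNorm _
  have h4 : m * ‖u - v‖ < ε / 2 := by
    rw [lt_div_iff₀ (by positivity)] at hvD
    linarith
  have h5 : 0 ≤ ‖u - v‖ := norm_nonneg _
  calc ‖A n u - B u‖ ≤ ‖A n (u - v)‖ + ‖B (u - v)‖ + ‖A n v - B v‖ := by
        rw [h1]
        exact (norm_add_le _ _).trans (add_le_add (norm_sub_le _ _) le_rfl)
    _ ≤ m * ‖u - v‖ + ‖A n v - B v‖ := by
        have : m * ‖u - v‖ = |b| * ‖u - v‖ + ‖B‖ * ‖u - v‖ + ‖u - v‖ := by ring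
        linarith
    _ < ε := by linarith

theorem norm_one_sub_starProjection_le (V : Submodule ℂ H) [V.HasOrthogonalProjection] :
    ‖(1 : H →L[ℂ] H) - V.starProjection‖ ≤ 1 := by
  have h := (Vᗮ).starProjection_norm_le
  rw [Submodule.starProjection_orthogonal] at h
  exact h

/-- The image of the unit ball is totally bounded. The contractions `1 - P_n` tend to `0` at
finitely many centres, hence uniformly on that image. -/
theorem tendsto_norm_one_sub_starProjection_comp [CompleteSpace H] (e : HilbertBasis ℕ ℂ H)
    {L : H →L[ℂ] H} (hL : IsCompactOperator L) :
    Tendsto (fun n => ‖(1 - (basisSpan e n).starProjection) ∘L L‖) atTop (𝓝 0) := by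
  rw [Metric.tendsto_nhds]
  intro ε hε
  obtain ⟨S, hS, hLS⟩ := IsCompactOperator.image_closedBall_subset_compact
    (f := L.toLinearMap) hL 1
  obtain ⟨t, -, htf, ht⟩ := totallyBounded_iff_subset.1 hS.totallyBounded _
    (Metric.dist_mem_uniformity (show 0 < ε / 4 by positivity))
  have hev : ∀ᶠ n in atTop, ∀ y ∈ t, ‖(1 - (basisSpan e n).starProjection) y‖ < ε / 4 := by
    rw [eventually_all_finite htf]
    intro y _
    have h := (starProjection_basisSpan_tendsto e y).const_sub y
    rw [sub_self] at h
    have := h.norm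
    rw [norm_zero] at this
    exact this.eventually_lt_const (by positivity)
  filter_upwards [hev] with n hn
  rw [dist_zero_right, norm_norm]
  refine lt_of_le_of_lt (b := ε / 2) ?_ (by linarith)
  refine ContinuousLinearMap.opNorm_le_of_unit_norm (by positivity) fun x hx => ?_
  have hxS : L x ∈ S := hLS ⟨x, by simp [hx], rfl⟩
  obtain ⟨y, hy, hxy⟩ := Set.mem_iUnion₂.1 (ht hxS)
  have hxy' : ‖L x - y‖ < ε / 4 := by
    rw [← dist_eq_norm]
    exact hxy
  have h1 : ((1 - (basisSpan e n).starProjection) ∘L L) x =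
      (1 - (basisSpan e n).starProjection) (L x - y) +
        (1 - (basisSpan e n).starProjection) y := by
    rw [← map_add, sub_add_cancel]
    rfl
  have h2 := ContinuousLinearMap.le_of_opNorm_le _
    (norm_one_sub_starProjection_le (basisSpan e n)) (L x - y)
  rw [h1]
  refine (norm_add_le _ _).trans ?_
  linarith [hn y hy]

/-- By the C*-identity `‖L Q‖² = ‖Q L* L Q‖ ≤ ‖Q L* L‖`, and `L* L` is compact, so the previous
lemma applies. -/
theorem tendsto_norm_comp_one_sub_starProjection [CompleteSpace H] (e : HilbertBasis ℕ ℂ H)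
    {L : H →L[ℂ] H} (hL : IsCompactOperator L) :
    Tendsto (fun n => ‖L ∘L (1 - (basisSpan e n).starProjection)‖) atTop (𝓝 0) := by
  have hLL : IsCompactOperator (L.adjoint ∘L L) := hL.clm_comp L.adjoint
  have h := (tendsto_norm_one_sub_starProjection_comp e hLL).sqrt
  rw [Real.sqrt_zero] at h
  refine squeeze_zero (fun _ => norm_nonneg _) (fun n => ?_) h
  refine Real.le_sqrt_of_sq_le ?_
  set Q : H →L[ℂ] H := 1 - (basisSpan e n).starProjection with hQ
  have hQa : Q.adjoint = Q := by
    rw [← ContinuousLinearMap.star_eq_adjoint, hQ, star_sub, star_one,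
      (isSelfAdjoint_starProjection _).star_eq]
  rw [sq, ← ContinuousLinearMap.norm_adjoint_comp_self, ContinuousLinearMap.adjoint_comp, hQa]
  have : (Q ∘L L.adjoint) ∘L L ∘L Q = (Q ∘L L.adjoint ∘L L) ∘L Q := rfl
  rw [this]
  refine (ContinuousLinearMap.opNorm_comp_le _ _).trans ?_
  exact mul_le_of_le_one_right (norm_nonneg _) (norm_one_sub_starProjection_le _)

end Projections

/-! ### Off-diagonal decay -/

section OffDiagonal

variable {H : Type*} [NormedAddCommGroup H] [InnerProductSpace ℂ H]
  {e : HilbertBasis ℕ ℂ H} {X : H →ₗ.[ℂ] H} {he : ∀ k, e k ∈ X.domain}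

/-- Under exponential off-diagonal decay, the operators `(1 - P_n) X P_n` are uniformly bounded. -/
theorem OffDiagonalDecay.exists_norm_sub_starProjection_le (h : OffDiagonalDecay e X he) :
    ∃ β : ℝ, 0 ≤ β ∧ ∀ (n : ℕ) (x : X.domain), (x : H) ∈ basisSpan e n →
      ‖X x - (basisSpan e n).starProjection (X x)‖ ≤ β * ‖(x : H)‖ := by
  obtain ⟨C, hC, α, hα, h⟩ := h
  set r : ℝ := Real.exp (-α) with hr
  have hr0 : 0 < r := Real.exp_pos _
  have hr1 : r < 1 := by simpa [hr] using hα
  have h1r : 0 < (1 - r)⁻¹ := inv_pos.2 (by linarith)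
  have hentry : ∀ j k : ℕ, k < j → ‖inner ℂ (e j) (X ⟨e k, he k⟩)‖ ≤ C * r ^ (j - k) := by
    intro j k hkj
    refine (h j k hkj.ne').trans_eq ?_
    rw [hr, ← Real.exp_nat_mul, Nat.cast_sub hkj.le, abs_of_pos (sub_pos.2 (Nat.cast_lt.2 hkj)),
      mul_comm (-α)]
  have hcol : ∀ n k : ℕ, k < n → ‖X ⟨e k, he k⟩ -
      (basisSpan e n).starProjection (X ⟨e k, he k⟩)‖ ≤ C * r ^ (n - k) * (1 - r)⁻¹ := by
    intro n k hkn
    set w := X ⟨e k, he k⟩ with hw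
    set v := w - (basisSpan e n).starProjection w with hv
    have hs := e.hasSum_repr v
    simp only [HilbertBasis.repr_apply_apply] at hs
    -- The first `n` coordinates of `v` vanish; the others are dominated by a geometric series
    -- starting at `C r ^ (n - k)`.
    rw [← hasSum_nat_add_iff' n, Finset.sum_eq_zero, sub_zero] at hs
    · refine hs.norm_le_of_bounded ((hasSum_geometric_of_lt_one hr0.le hr1).mul_left _)
        fun i => ?_
      rw [norm_smul, e.orthonormal.1, mul_one, hv, inner_sub_right,
        inner_basis_eq_zero e (Nat.le_add_left n i) (Submodule.starProjection_apply_mem _ _),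
        sub_zero]
      refine (hentry _ _ (by omega)).trans_eq ?_
      rw [mul_assoc, ← pow_add]
      congr 2
      omega
    · intro j hj
      have := Submodule.starProjection_inner_eq_zero (K := basisSpan e n) w (e j)
        (basis_mem_basisSpan e (Finset.mem_range.1 hj))
      rw [inner_eq_zero_symm.1 this, zero_smul]
  -- One factor `(1 - r)⁻¹` sums the tail of a column, the other sums over the columns `k < n`; each
  -- coefficient of `x` is at most `‖x‖`.
  refine ⟨C * (1 - r)⁻¹ * (1 - r)⁻¹, by positivity, fun n x hx => ?_⟩
  have hxsum : x = ∑ k ∈ Finset.range n, inner ℂ (e k) (x : H) • (⟨e k, he k⟩ : X.domain) := by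
    apply Subtype.ext
    simpa using eq_sum_of_mem_basisSpan e hx
  let Q : X.domain →ₗ[ℂ] H :=
    ((1 : H →L[ℂ] H) - (basisSpan e n).starProjection).toLinearMap ∘ₗ X.toFun
  have hQ : ∀ y : X.domain, Q y = X y - (basisSpan e n).starProjection (X y) := fun y => rfl
  have hgeom : ∑ k ∈ Finset.range n, r ^ (n - k) ≤ (1 - r)⁻¹ := by
    have h1 : ∑ k ∈ Finset.range n, r ^ (n - k) = ∑ k ∈ Finset.range n, r ^ (k + 1) := by
      rw [← Finset.sum_range_reflect]
      refine Finset.sum_congr rfl fun k hk => ?_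
      have := Finset.mem_range.1 hk
      congr 1
      omega
    rw [h1, ← tsum_geometric_of_lt_one hr0.le hr1]
    refine le_trans (Finset.sum_le_sum fun k _ => ?_)
      ((summable_geometric_of_lt_one hr0.le hr1).sum_le_tsum _ fun k _ => by positivity)
    exact pow_le_pow_of_le_one hr0.le hr1.le k.le_succ
  calc ‖X x - (basisSpan e n).starProjection (X x)‖
      = ‖∑ k ∈ Finset.range n, inner ℂ (e k) (x : H) • Q ⟨e k, he k⟩‖ := by
        rw [← hQ]
        conv_lhs => rw [hxsum]
        simp only [map_sum, map_smul]
    _ ≤ ∑ k ∈ Finset.range n, ‖(x : H)‖ * (C * r ^ (n - k) * (1 - r)⁻¹) := by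
        refine (norm_sum_le _ _).trans (Finset.sum_le_sum fun k hk => ?_)
        rw [norm_smul]
        refine mul_le_mul ?_ (hcol n k (Finset.mem_range.1 hk)) (norm_nonneg _) (norm_nonneg _)
        refine (norm_inner_le_norm _ _).trans_eq ?_
        rw [e.orthonormal.1, one_mul]
    _ = C * (1 - r)⁻¹ * (∑ k ∈ Finset.range n, r ^ (n - k)) * ‖(x : H)‖ := by
        rw [Finset.mul_sum, Finset.sum_mul]
        exact Finset.sum_congr rfl fun k _ => by ring
    _ ≤ C * (1 - r)⁻¹ * (1 - r)⁻¹ * ‖(x : H)‖ := by gcongr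

end OffDiagonal

/-! ### Resolvents of the compressions -/

section Compression

variable {H : Type*} [NormedAddCommGroup H] [InnerProductSpace ℂ H]
  {e : HilbertBasis ℕ ℂ H} {X : H →ₗ.[ℂ] H} {he : ∀ k, e k ∈ X.domain}

theorem coe_compression_apply (n : ℕ) (x : basisSpan e n) :
    (compression e X he n x : H) =
      (basisSpan e n).starProjection (X ⟨x, basisSpan_le_domain he n x.2⟩) := rfl

theorem fullCompression_apply (n : ℕ) (x : H) :
    fullCompression e X he n x =
      compression e X he n ((basisSpan e n).orthogonalProjectionOnto x) := rfl

theorem orthogonalProjectionOnto_fullCompression_apply (n : ℕ) (x : H) :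
    (basisSpan e n).orthogonalProjectionOnto (fullCompression e X he n x) =
      compression e X he n ((basisSpan e n).orthogonalProjectionOnto x) := by
  rw [fullCompression_apply, Submodule.orthogonalProjectionOnto_mem_subspace_eq_self]

/-- A lower bound for `z - X_n` on `Range(P_n)`, in terms of the resolvent of `X`. -/
theorem norm_le_of_compression {z : ℂ} (hz : z ∈ unboundedResolventSet X) {β : ℝ} {n : ℕ}
    (hβ : ∀ x : X.domain, (x : H) ∈ basisSpan e n →
      ‖X x - (basisSpan e n).starProjection (X x)‖ ≤ β * ‖(x : H)‖)
    (hn : ‖unboundedResolvent X z ∘L (1 - (basisSpan e n).starProjection)‖ * β ≤ 1 / 2)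
    (x : basisSpan e n) :
    ‖x‖ ≤ 2 * ‖unboundedResolvent X z‖ * ‖z • x - compression e X he n x‖ := by
  set R := unboundedResolvent X z
  set Q : H →L[ℂ] H := 1 - (basisSpan e n).starProjection with hQ
  set x' : X.domain := ⟨x, basisSpan_le_domain he n x.2⟩ with hx'
  -- Idempotence splits `R Q X x` into the small operator `R Q` applied to the bounded vector `Q X
  -- x`.
  have hQQ : ∀ y, Q (Q y) = Q y := by
    intro y
    have h : (basisSpan e n).starProjection ((basisSpan e n).starProjection y) =
        (basisSpan e n).starProjection y :=
      Submodule.starProjection_eq_self_iff.2 (Submodule.starProjection_apply_mem _ _)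
    simp [hQ, h]
  have h1 : z • (x : H) - X x' = ((z • x - compression e X he n x : basisSpan e n) : H) -
      Q (X x') := by
    rw [Submodule.coe_sub, Submodule.coe_smul, coe_compression_apply]
    simp [hQ, hx']
  have h2 : (x : H) = R ((z • x - compression e X he n x : basisSpan e n) : H) -
      (R ∘L Q) (Q (X x')) := by
    rw [ContinuousLinearMap.comp_apply, hQQ, ← map_sub, ← h1]
    exact (unboundedResolvent_apply_sub hz x').symm
  have h3 : ‖(R ∘L Q) (Q (X x'))‖ ≤ 1 / 2 * ‖x‖ := by
    calc ‖(R ∘L Q) (Q (X x'))‖ ≤ ‖R ∘L Q‖ * (β * ‖x‖) :=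
          (R ∘L Q).le_opNorm_of_le (hβ x' x.2)
      _ = ‖R ∘L Q‖ * β * ‖x‖ := by ring
      _ ≤ 1 / 2 * ‖x‖ := by gcongr
  have h4 := R.le_opNorm ((z • x - compression e X he n x : basisSpan e n) : H)
  have h5 : ‖x‖ ≤ ‖R ((z • x - compression e X he n x : basisSpan e n) : H)‖ +
      ‖(R ∘L Q) (Q (X x'))‖ := by
    rw [Submodule.coe_norm x]
    conv_lhs => rw [h2]
    exact norm_sub_le _ _
  rw [← Submodule.coe_norm] at h4
  linarith

/-- In finite dimension, a lower bound for `z - T` bounds the resolvent. -/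
theorem notMem_spectrum_of_norm_le {V : Type*} [NormedAddCommGroup V] [NormedSpace ℂ V]
    [FiniteDimensional ℂ V] {T : V →L[ℂ] V} {z : ℂ} {b : ℝ}
    (h : ∀ x, ‖x‖ ≤ b * ‖z • x - T x‖) :
    z ∉ spectrum ℂ T ∧ ∀ y, ‖resolvent T z y‖ ≤ b * ‖y‖ := by
  have : CompleteSpace V := FiniteDimensional.complete ℂ V
  set S : V →L[ℂ] V := algebraMap ℂ (V →L[ℂ] V) z - T with hS
  have hSx : ∀ x, S x = z • x - T x := by
    intro x
    simp [hS, ContinuousLinearMap.algebraMap_apply]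
  have hinj : Function.Injective S.toLinearMap := by
    rw [← LinearMap.ker_eq_bot, LinearMap.ker_eq_bot']
    intro x hx
    have h1 := h x
    rw [← hSx] at h1
    have h2 : S x = 0 := hx
    rw [h2, norm_zero, mul_zero] at h1
    exact norm_le_zero_iff.1 h1
  have hunit : IsUnit S :=
    ContinuousLinearMap.isUnit_iff_bijective.2 ⟨hinj, LinearMap.injective_iff_surjective.1 hinj⟩
  refine ⟨fun hz => hz hunit, fun y => ?_⟩
  have h1 : S (resolvent T z y) = y := by
    have := congrArg (fun A : V →L[ℂ] V => A y) (Ring.mul_inverse_cancel S hunit)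
    exact this
  have h2 := h (resolvent T z y)
  rwa [← hSx, h1] at h2

theorem resolvent_apply_sub {V : Type*} [NormedAddCommGroup V] [NormedSpace ℂ V]
    {T : V →L[ℂ] V} {z : ℂ} (hz : z ∉ spectrum ℂ T) (x : V) :
    resolvent T z (z • x - T x) = x := by
  have hunit : IsUnit (algebraMap ℂ (V →L[ℂ] V) z - T) := not_not.1 hz
  have := congrArg (fun A : V →L[ℂ] V => A x) (Ring.inverse_mul_cancel _ hunit)
  simpa [resolvent, ContinuousLinearMap.algebraMap_apply] using this

theorem sub_resolvent_apply {V : Type*} [NormedAddCommGroup V] [NormedSpace ℂ V]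
    {T : V →L[ℂ] V} {z : ℂ} (hz : z ∉ spectrum ℂ T) (x : V) :
    z • resolvent T z x - T (resolvent T z x) = x := by
  have hunit : IsUnit (algebraMap ℂ (V →L[ℂ] V) z - T) := not_not.1 hz
  have := congrArg (fun A : V →L[ℂ] V => A x) (Ring.mul_inverse_cancel _ hunit)
  simpa [resolvent, ContinuousLinearMap.algebraMap_apply] using this

/-- On the whole space, the compression acts as `0` on the complement of `Range(P_n)`. -/
theorem fullCompression_resolvent {n : ℕ} {z : ℂ} (hz0 : z ≠ 0)
    (hz : z ∉ spectrum ℂ (compression e X he n)) :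
    z ∉ spectrum ℂ (fullCompression e X he n) ∧ ∀ u, resolvent (fullCompression e X he n) z u =
      resolvent (compression e X he n) z ((basisSpan e n).orthogonalProjectionOnto u) +
        z⁻¹ • (u - (basisSpan e n).starProjection u) := by
  set T := compression e X he n
  set P := (basisSpan e n).orthogonalProjectionOnto with hP
  -- The inverse is block diagonal: the compressed resolvent on `Range(P_n)` and `z⁻¹` on its
  -- complement.
  set A : H →L[ℂ] H := (basisSpan e n).subtypeL ∘L resolvent T z ∘L P +
    z⁻¹ • (1 - (basisSpan e n).starProjection) with hA
  have hAu : ∀ u, A u = resolvent T z (P u) + z⁻¹ • (u - (basisSpan e n).starProjection u) :=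
    fun u => rfl
  have hPP : ∀ v : basisSpan e n, P (v : H) = v :=
    Submodule.orthogonalProjectionOnto_mem_subspace_eq_self
  have hstar : ∀ u, (basisSpan e n).starProjection u = P u := fun u => rfl
  have hPA : ∀ u, P (A u) = resolvent T z (P u) := by
    intro u
    rw [hAu, hstar, map_add, map_smul, map_sub, hPP, hPP, sub_self, smul_zero, add_zero]
  have hright : (algebraMap ℂ (H →L[ℂ] H) z - fullCompression e X he n) * A = 1 := by
    ext u
    have h := congrArg (fun v : basisSpan e n => (v : H)) (sub_resolvent_apply hz (P u))
    simp only [Submodule.coe_sub, Submodule.coe_smul] at h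
    simp only [mul_apply_eq_comp, sub_apply, ContinuousLinearMap.algebraMap_apply,
      one_apply_eq_self, fullCompression_apply]
    rw [← hP, hPA, hAu, smul_add, smul_inv_smul₀ hz0, hstar, add_sub_right_comm]
    erw [h]
    abel
  have hleft : A * (algebraMap ℂ (H →L[ℂ] H) z - fullCompression e X he n) = 1 := by
    ext u
    simp only [mul_apply_eq_comp, sub_apply, ContinuousLinearMap.algebraMap_apply,
      one_apply_eq_self]
    rw [hAu, hstar, map_sub, map_smul, hP, orthogonalProjectionOnto_fullCompression_apply, ← hP,
      resolvent_apply_sub hz, fullCompression_apply, ← hP, Submodule.coe_sub, Submodule.coe_smul]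
    rw [show z • u - (T (P u) : H) - (z • (P u : H) - (T (P u) : H)) = z • (u - (P u : H)) by
      module, inv_smul_smul₀ hz0]
    abel
  have hunit : IsUnit (algebraMap ℂ (H →L[ℂ] H) z - fullCompression e X he n) :=
    ⟨⟨_, _, hright, hleft⟩, rfl⟩
  refine ⟨fun h => h hunit, fun u => ?_⟩
  rw [← hAu, resolvent, ← mul_one (Ring.inverse _), ← hright, ← mul_assoc,
    Ring.inverse_mul_cancel _ hunit, one_mul]

/-- If `S` is a core for `X`, then `z - X` maps `S` onto a dense subspace. -/
theorem LinearPMap.HasCore.dense_image (hX : X.IsClosed) {S : Submodule ℂ H} (hS : X.HasCore S)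
    {z : ℂ} (hz : z ∈ unboundedResolventSet X) :
    Dense {u : H | ∃ x : X.domain, (x : H) ∈ S ∧ z • (x : H) - X x = u} := by
  intro y
  have hle : X.domRestrict S ≤ X := LinearPMap.domRestrict_le
  have hcl : (X.domRestrict S).graph.topologicalClosure = X.graph := by
    rw [(hX.isClosable.leIsClosable hle).graph_closure_eq_closure_graph, hS.closure_eq]
  -- This graph point is a limit of graph points over `S`, and the continuous map `(a, b) ↦ z a - b`
  -- sends it to `y`.
  have hmem : ((unboundedResolvent X z y, X ⟨_, unboundedResolvent_mem_domain hz y⟩) : H × H) ∈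
      _root_.closure ((X.domRestrict S).graph : Set (H × H)) := by
    rw [← Submodule.topologicalClosure_coe, hcl]
    exact LinearPMap.mem_graph X ⟨_, unboundedResolvent_mem_domain hz y⟩
  have hcont : Continuous fun p : H × H => z • p.1 - p.2 := by fun_prop
  have h := map_mem_closure hcont hmem
    (t := {u : H | ∃ x : X.domain, (x : H) ∈ S ∧ z • (x : H) - X x = u}) ?_
  · simpa [apply_unboundedResolvent hz y] using h
  · rintro ⟨a, b⟩ hab
    obtain ⟨x, rfl, rfl⟩ := (LinearPMap.mem_graph_iff _).1 hab
    exact ⟨⟨x, hle.1 x.2⟩, x.2.1, congrArg _ (hle.2 rfl).symm⟩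

variable [CompleteSpace H]

/-- For large `n`, the resolvents of the compressions are controlled by that of `X`, on each closed
set on which the operators `(w - X) (z - X)⁻¹` are bounded. -/
theorem eventually_notMem_spectrum_compression (hX : X.IsClosed) (hcpt : HasCompactResolvent X)
    (hdecay : OffDiagonalDecay e X he) {K : Set ℂ} (hK : IsClosed K)
    (hKρ : K ⊆ unboundedResolventSet X) (hcase : IsCompact K ∨ X.domain = ⊤) :
    ∀ᶠ n in atTop, ∀ z ∈ K, z ∉ spectrum ℂ (compression e X he n) ∧
      ∀ y, ‖resolvent (compression e X he n) z y‖ ≤ 2 * ‖unboundedResolvent X z‖ * ‖y‖ := by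
  obtain ⟨w, hw, hcpt⟩ := hcpt
  obtain ⟨β, hβ0, hβ⟩ := hdecay.exists_norm_sub_starProjection_le
  obtain ⟨A, hA0, hA⟩ := exists_norm_one_add_smul_unboundedResolvent_le hX hK hKρ hcase w
  have hlim := ((tendsto_norm_comp_one_sub_starProjection e hcpt).const_mul A).mul_const β
  rw [mul_zero, zero_mul] at hlim
  filter_upwards [hlim.eventually_lt_const (show (0 : ℝ) < 1 / 2 by norm_num)] with n hn z hz
  refine notMem_spectrum_of_norm_le
    (norm_le_of_compression (hKρ hz) (hβ n) (le_trans ?_ hn.le))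
  gcongr
  -- With the compact factor `R(w)` on the right, `‖R(z) Q‖ ≤ A ‖R(w) Q‖`, uniformly on `K`.
  have h : unboundedResolvent X z = (1 + (w - z) • unboundedResolvent X z) ∘L
      unboundedResolvent X w := by
    ext y
    have h1 := congrArg (fun S : H →L[ℂ] H => S y) (unboundedResolvent_eq_comp hw (hKρ hz))
    simp only [ContinuousLinearMap.comp_apply, add_apply, one_apply_eq_self, smul_apply, map_add,
      map_smul] at h1 ⊢
    linear_combination (norm := module) (-1 : ℂ) • h1
  conv_lhs => rw [h]
  rw [ContinuousLinearMap.comp_assoc]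
  refine (ContinuousLinearMap.opNorm_comp_le _ _).trans ?_
  gcongr
  exact hA z hz

end Compression

/-! ### Strong convergence -/

section StrongConvergence

variable {H : Type*} [NormedAddCommGroup H] [InnerProductSpace ℂ H]
  {e : HilbertBasis ℕ ℂ H} {X : H →ₗ.[ℂ] H} {he : ∀ k, e k ∈ X.domain}

/-- Uniformly bounded resolvents of the compressions converge strongly. -/
theorem tendsto_resolvent_compression (hX : X.IsClosed) (hcore : X.HasCore (⨆ n, basisSpan e n))
    {z : ℂ} (hz : z ∈ unboundedResolventSet X) {b : ℝ} (hb0 : 0 ≤ b)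
    (hb : ∀ᶠ n in atTop, z ∉ spectrum ℂ (compression e X he n) ∧
      ∀ y, ‖resolvent (compression e X he n) z y‖ ≤ b * ‖y‖) (u : H) :
    Tendsto (fun n => (resolvent (compression e X he n) z
      ((basisSpan e n).orthogonalProjectionOnto u) : H)) atTop (𝓝 (unboundedResolvent X z u)) := by
  refine tendsto_clm_of_dense (b := b)
    (A := fun n => (basisSpan e n).subtypeL ∘L resolvent (compression e X he n) z ∘L
      (basisSpan e n).orthogonalProjectionOnto) ?_ (hcore.dense_image hX hz) ?_ u
  · filter_upwards [hb] with n hn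
    refine ContinuousLinearMap.opNorm_le_bound _ hb0 fun y => ?_
    refine (hn.2 _).trans ?_
    gcongr
    exact Submodule.norm_orthogonalProjectionOnto_apply_le _ _
  · rintro v ⟨x, hx, rfl⟩
    obtain ⟨m, hm⟩ := (Submodule.mem_iSup_of_directed _ (basisSpan_mono e).directed_le).1 hx
    -- Once `x` lies in `Range(P_n)`, `P_n (z - X) x = (z - X_n) x`, so the compressed resolvent
    -- returns exactly `x`.
    refine tendsto_const_nhds.congr' ?_
    filter_upwards [hb, eventually_ge_atTop m] with n hn hmn
    have hxn : (x : H) ∈ basisSpan e n := basisSpan_mono e hmn hm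
    have h1 : (basisSpan e n).orthogonalProjectionOnto (z • (x : H) - X x) =
        z • (⟨x, hxn⟩ : basisSpan e n) - compression e X he n ⟨x, hxn⟩ := by
      rw [map_sub, map_smul]
      refine congrArg₂ (· - ·) (congrArg _ ?_) rfl
      exact Submodule.orthogonalProjectionOnto_mem_subspace_eq_self ⟨(x : H), hxn⟩
    have h2 : ((basisSpan e n).subtypeL ∘L resolvent (compression e X he n) z ∘L
        (basisSpan e n).orthogonalProjectionOnto) (z • (x : H) - X x) = x := by
      rw [ContinuousLinearMap.comp_apply, ContinuousLinearMap.comp_apply, h1,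
        resolvent_apply_sub hn.1]
      rfl
    rw [h2, unboundedResolvent_apply_sub hz]

variable [CompleteSpace H]

theorem strong_convergence {f : ℂ → ℂ} {U : Set ℂ} (hf : ContinuousOn f U) {Γ : Contour} {c : ℂ}
    (hX : X.IsClosed) (hcpt : HasCompactResolvent X) (hcore : X.HasCore (⨆ n, basisSpan e n))
    (hdecay : OffDiagonalDecay e X he) :
    (Γ.Admissible f c U (unboundedSpectrum X) (X.domain = ⊤) →
      (∀ᶠ n in atTop, Γ.Admissible f c U (spectrum ℂ (compression e X he n)) True) ∧
        ∀ u : H, Tendsto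
          (fun n => (dunfordTaylor f c Γ (resolvent (compression e X he n))
            ((basisSpan e n).orthogonalProjectionOnto u) : H))
          atTop (𝓝 (dunfordTaylor f c Γ (unboundedResolvent X) u))) ∧
    (Γ.Admissible f c U (unboundedSpectrum X ∪ {0}) (X.domain = ⊤) →
      (∀ᶠ n in atTop, Γ.Admissible f c U (spectrum ℂ (fullCompression e X he n)) True) ∧
        ∀ u : H, Tendsto
          (fun n => dunfordTaylor f c Γ (resolvent (fullCompression e X he n)) u)
          atTop (𝓝 (dunfordTaylor f c Γ (unboundedResolvent X) u))) := by
  -- Spectral avoidance is needed on all of `K` for the index conditions; bounds and limits of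
  -- resolvents only on the contour.
  have main : ∀ K : Set ℂ, IsClosed K → Γ.image ⊆ K →
      Disjoint K (unboundedSpectrum X) → (IsCompact K ∨ X.domain = ⊤) →
      ∃ b : ℝ, 0 ≤ b ∧ K ⊆ unboundedResolventSet X ∧
        (∀ᶠ n in atTop, ∀ z ∈ K, z ∉ spectrum ℂ (compression e X he n)) ∧
        (∀ᶠ n in atTop, ∀ z ∈ Γ.image, ∀ y,
          ‖resolvent (compression e X he n) z y‖ ≤ b * ‖y‖) ∧
        ∀ z ∈ Γ.image, ∀ u : H, Tendsto (fun n => (resolvent (compression e X he n) z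
          ((basisSpan e n).orthogonalProjectionOnto u) : H)) atTop
            (𝓝 (unboundedResolvent X z u)) := by
    intro K hK hΓK hKX hcase
    have hKρ : K ⊆ unboundedResolventSet X := fun z hz =>
      not_not.1 (Set.disjoint_left.1 hKX hz)
    obtain ⟨M, hM⟩ := Γ.isCompact_image.exists_bound_of_continuousOn
      ((continuousOn_unboundedResolvent X).mono (hΓK.trans hKρ))
    have hev := eventually_notMem_spectrum_compression (e := e) (he := he) hX hcpt hdecay hK hKρ
      hcase
    have hbd : ∀ᶠ n in atTop, ∀ z ∈ Γ.image, ∀ y,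
        ‖resolvent (compression e X he n) z y‖ ≤ 2 * |M| * ‖y‖ := by
      filter_upwards [hev] with n hn z hz y
      refine ((hn z (hΓK hz)).2 y).trans ?_
      gcongr
      exact (hM z hz).trans (le_abs_self M)
    refine ⟨2 * |M|, by positivity, hKρ, hev.mono fun n hn z hz => (hn z hz).1, hbd,
      fun z hz u => ?_⟩
    refine tendsto_resolvent_compression hX hcore (hKρ (hΓK hz))
      (b := 2 * |M|) (by positivity) ?_ u
    filter_upwards [hev, hbd] with n hn hn'
    exact ⟨(hn z (hΓK hz)).1, hn' z hz⟩
  constructor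
  · intro hadm
    obtain ⟨hΓU, K, hK, hΓK, hKX, hcase, hadm'⟩ := hadm.exists_closed
    obtain ⟨b, hb0, hKρ, hspec, hbd, hlim⟩ := main K hK hΓK hKX hcase
    have hfΓ := hf.mono hΓU
    obtain ⟨m, hm⟩ := Γ.isCompact_image.exists_bound_of_continuousOn hfΓ
    have hdisj : ∀ᶠ n in atTop, Disjoint K (spectrum ℂ (compression e X he n)) :=
      hspec.mono fun n hn => Set.disjoint_left.2 hn
    refine ⟨hdisj.mono fun n hn => hadm' _ hn, fun u => ?_⟩
    have hcts : ∀ᶠ n in atTop, ContinuousOn (fun z => f z • resolvent (compression e X he n) z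
        ((basisSpan e n).orthogonalProjectionOnto u)) Γ.image := by
      filter_upwards [hdisj] with n hn
      have : CompleteSpace (basisSpan e n) := FiniteDimensional.complete ℂ _
      exact hfΓ.fun_smul
        ((continuousOn_resolvent (hn.mono_left hΓK)).clm_apply continuousOn_const)
    rw [dunfordTaylor_apply hfΓ c ((continuousOn_unboundedResolvent X).mono (hΓK.trans hKρ))]
    have hint : Tendsto (fun n => Γ.integral (fun z => f z •
        (resolvent (compression e X he n) z ((basisSpan e n).orthogonalProjectionOnto u) : H)))
        atTop (𝓝 (Γ.integral fun z => f z • unboundedResolvent X z u)) := by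
      refine Contour.tendsto_integral (b := |m| * (b * ‖u‖)) ?_ ?_
        fun z hz => (hlim z hz u).const_smul _
      · filter_upwards [hcts] with n hn
        exact (basisSpan e n).subtypeL.continuous.comp_continuousOn hn
      · filter_upwards [hbd] with n hn z hz
        rw [norm_smul]
        refine mul_le_mul ((hm z hz).trans (le_abs_self m)) ((hn z hz _).trans ?_)
          (norm_nonneg _) (abs_nonneg _)
        gcongr
        exact Submodule.norm_orthogonalProjectionOnto_apply_le _ _
    -- The identity here is that of `Range(P_n)`, so the constant term is `c P_n u`, which tends to
    -- `c u`.
    refine (((starProjection_basisSpan_tendsto e u).const_smul c).add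
      (hint.const_smul (2 * Real.pi * Complex.I : ℂ)⁻¹)).congr' ?_
    filter_upwards [hdisj, hcts] with n hn hn'
    have : CompleteSpace (basisSpan e n) := FiniteDimensional.complete ℂ _
    rw [dunfordTaylor_apply hfΓ c (continuousOn_resolvent (hn.mono_left hΓK)),
      Submodule.coe_add, Submodule.coe_smul, Submodule.coe_smul]
    have h := Γ.clm_integral_comm (basisSpan e n).subtypeL hn'
    simp only [map_smul] at h
    exact congrArg _ (congrArg _ h.symm)
  · intro hadm
    obtain ⟨hΓU, K, hK, hΓK, hKX, hcase, hadm'⟩ := hadm.exists_closed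
    obtain ⟨b, hb0, hKρ, hspec, hbd, hlim⟩ :=
      main K hK hΓK (hKX.mono_right Set.subset_union_left) hcase
    -- Enclosing `0` keeps it out of `K`, so the block `z⁻¹ (1 - P_n)` of the resolvent is bounded
    -- on the contour; it tends strongly to `0`.
    have hK0 : ∀ z ∈ K, z ≠ 0 := fun z hz h0 =>
      Set.disjoint_left.1 hKX hz (Or.inr h0)
    have hfΓ := hf.mono hΓU
    obtain ⟨m, hm⟩ := Γ.isCompact_image.exists_bound_of_continuousOn hfΓ
    obtain ⟨d, hd⟩ := Γ.isCompact_image.exists_bound_of_continuousOn (f := fun z : ℂ => z⁻¹)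
      (continuousOn_id.inv₀ fun z hz => hK0 z (hΓK hz))
    have hdisj : ∀ᶠ n in atTop, Disjoint K (spectrum ℂ (fullCompression e X he n)) :=
      hspec.mono fun n hn => Set.disjoint_left.2 fun z hz =>
        (fullCompression_resolvent (hK0 z hz) (hn z hz)).1
    refine ⟨hdisj.mono fun n hn => hadm' _ hn, fun u => ?_⟩
    rw [dunfordTaylor_apply hfΓ c ((continuousOn_unboundedResolvent X).mono (hΓK.trans hKρ))]
    have hint : Tendsto (fun n => Γ.integral (fun z => f z •
        resolvent (fullCompression e X he n) z u))
        atTop (𝓝 (Γ.integral fun z => f z • unboundedResolvent X z u)) := by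
      refine Contour.tendsto_integral (b := |m| * (b * ‖u‖ + |d| * ‖u‖)) ?_ ?_
        fun z hz => Tendsto.const_smul ?_ _
      · filter_upwards [hdisj] with n hn
        exact hfΓ.fun_smul
          ((continuousOn_resolvent (hn.mono_left hΓK)).clm_apply continuousOn_const)
      · filter_upwards [hbd, hspec] with n hn hn' z hz
        rw [norm_smul,
          (fullCompression_resolvent (hK0 z (hΓK hz)) (hn' z (hΓK hz))).2]
        refine mul_le_mul ((hm z hz).trans (le_abs_self m)) ((norm_add_le _ _).trans ?_)
          (norm_nonneg _) (abs_nonneg _)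
        refine add_le_add ((hn z hz _).trans ?_) ?_
        · gcongr
          exact Submodule.norm_orthogonalProjectionOnto_apply_le _ _
        · rw [norm_smul]
          refine mul_le_mul ((hd z hz).trans (le_abs_self d)) ?_ (norm_nonneg _) (abs_nonneg _)
          have := ContinuousLinearMap.le_of_opNorm_le _
            (norm_one_sub_starProjection_le (basisSpan e n)) u
          rwa [one_mul] at this
      · have h1 := ((starProjection_basisSpan_tendsto e u).const_sub u).const_smul z⁻¹
        rw [sub_self, smul_zero] at h1
        have h2 := (hlim z hz u).add h1
        rw [add_zero] at h2
        refine h2.congr' ?_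
        filter_upwards [hspec] with n hn
        exact ((fullCompression_resolvent (hK0 z (hΓK hz)) (hn z (hΓK hz))).2 u).symm
    refine ((hint.const_smul (2 * Real.pi * Complex.I : ℂ)⁻¹).const_add (c • u)).congr' ?_
    filter_upwards [hdisj] with n hn
    rw [dunfordTaylor_apply hfΓ c (continuousOn_resolvent (hn.mono_left hΓK))]

end StrongConvergence

theorem mainTheorem3 {H : Type*} [NormedAddCommGroup H] [InnerProductSpace ℂ H] [CompleteSpace H]
    (f : ℂ → ℂ) (U : Set ℂ) (hU : IsOpen U) (hf : DifferentiableOn ℂ f U)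
    (Γ : Contour) (c : ℂ) :
    -- (i) strong convergence
    (∀ (e : HilbertBasis ℕ ℂ H) (X : H →ₗ.[ℂ] H) (he : ∀ k, e k ∈ X.domain),
      X.IsClosed → Dense (X.domain : Set H) →
      HasCompactResolvent X →
      X.HasCore (⨆ n, basisSpan e n) →
      OffDiagonalDecay e X he →
      Γ.Admissible f c U (unboundedSpectrum X) (X.domain = ⊤) →
      -- compressions acting on `Range(P_n)`
      ((∀ᶠ n in atTop, Γ.Admissible f c U (spectrum ℂ (compression e X he n)) True) ∧
        ∀ u : H, Tendsto
          (fun n => (dunfordTaylor f c Γ (resolvent (compression e X he n))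
            ((basisSpan e n).orthogonalProjectionOnto u) : H))
          atTop (𝓝 (dunfordTaylor f c Γ (unboundedResolvent X) u))) ∧
      -- compressions acting on the whole space, whose spectrum also contains `0`
      (Γ.Admissible f c U (unboundedSpectrum X ∪ {0}) (X.domain = ⊤) →
        (∀ᶠ n in atTop, Γ.Admissible f c U (spectrum ℂ (fullCompression e X he n)) True) ∧
        ∀ u : H, Tendsto
          (fun n => dunfordTaylor f c Γ (resolvent (fullCompression e X he n)) u)
          atTop (𝓝 (dunfordTaylor f c Γ (unboundedResolvent X) u)))) ∧
    -- (ii) norm convergence with a rate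
    (∀ (z₀ : ℂ) (M : ℝ), ∃ C : ℝ, 0 < C ∧
      ∀ (e : HilbertBasis ℕ ℂ H) (X : H →ₗ.[ℂ] H) (he : ∀ k, e k ∈ X.domain),
      X.IsClosed → Dense (X.domain : Set H) →
      Γ.Admissible f c U (unboundedSpectrum X) (X.domain = ⊤) →
      (∀ z ∈ Γ.image, ‖unboundedResolvent X z‖ ≤ M) →
      ∀ hz₀ : z₀ ∈ unboundedResolventSet X,
      Tendsto (fun n => ‖compressionError e X he z₀ hz₀ n‖) atTop (𝓝 0) →
      (∀ᶠ n in atTop, Γ.Admissible f c U (spectrum ℂ (fullCompression e X he n)) True) ∧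
      Tendsto (fun n => ‖dunfordTaylor f c Γ (resolvent (fullCompression e X he n)) -
        dunfordTaylor f c Γ (unboundedResolvent X)‖) atTop (𝓝 0) ∧
      ∀ᶠ n in atTop, ‖dunfordTaylor f c Γ (resolvent (fullCompression e X he n)) -
        dunfordTaylor f c Γ (unboundedResolvent X)‖ ≤ C * ‖compressionError e X he z₀ hz₀ n‖) := by
  refine ⟨fun e X he hX _ hcpt hcore hdecay hadm => ?_, fun z₀ M => ?_⟩
  · have h := strong_convergence (f := f) (U := U) (Γ := Γ) (c := c) hf.continuousOn hX hcpt hcore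
      hdecay
    exact ⟨h.1 hadm, h.2⟩
  · obtain ⟨C, hC, h⟩ := norm_convergence (H := H) hf.continuousOn Γ c z₀ M
    refine ⟨C, hC, fun e X he hX hdense hadm hM hz₀ hlim => ?_⟩
    obtain ⟨h1, h2⟩ := h e X he hX hdense hadm hM hz₀ hlim
    refine ⟨h1, ?_, h2⟩
    refine squeeze_zero' (Eventually.of_forall fun _ => norm_nonneg _) h2 ?_
    simpa using hlim.const_mul C
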